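/- Let $\Omega=\{x\in\mathbb R^3:|x|<1\}$, let $dS$ be surface measure on $\partial\Omega$, let $\Gamma_A\subset\partial\Omega$ be a nonempty relatively open set (for instance a finite union of open spherical caps), and let $\Gamma_R=\partial\Omega\setminus\Gamma_A$. For $x\in\overline\Omega$ and $x'\in\partial\Omega$ with $x\ne x'$, let \[ G_I(x,x')=\frac{2}{|x-x'|}+\log\left(\frac{2}{1-x\cdot x'+|x-x'|}\right) \] be the interior Neumann Green's function of the unit ball. Let $\sigma$ be a real-valued function on $\Gamma_A$, continuous on $\Gamma_A$ and integrable with respect to $dS$, that satisfies the first-kind integral equation \[ \int_{\Gamma_A}G_I(x,x')\,\sigma(x')\,dS(x')=1\qquad\text{for all }x\in\Gamma_A . \] Put $I_\sigma=\int_{\Gamma_A}\sigma\,dS$ and $v(x)=\int_{\Gamma_A}G_I(x,x')\,\sigma(x')\,dS(x')$. Then $v$ solves the mixed boundary value problem \[ \Delta v=0\ \text{ in }\Omega,\qquad v=1\ \text{ on }\Gamma_A,\qquad \frac{\partial v}{\partial n}=D\ \text{ on the relative interior of }\Gamma_R,\qquad\text{with } D=-I_\sigma , \] in the classical sense: with $\Gamma_R^\circ$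 the relative interior of $\Gamma_R$ in $\partial\Omega$, $v$ is continuous on $\Omega\cup\Gamma_A\cup\Gamma_R^\circ$, and $\partial v/\partial n$ is the outward normal derivative, taken from inside $\Omega$. Moreover $I_\sigma\neq0$. -/

import Mathlib

open MeasureTheory Metric Set

noncomputable section

/-- Three-dimensional Euclidean space. -/
abbrev Space3 : Type := EuclideanSpace ℝ (Fin 3)

/-- The unit sphere `∂Ω`, the boundary of the open unit ball `Ω = ball 0 1`. -/
abbrev UnitSphere : Type := sphere (0 : Space3) 1

/-- The surface measure `dS` on the unit sphere (of total mass `4π`). -/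
def surfaceMeasure : Measure UnitSphere := (volume : Measure Space3).toSphere

/-- The interior Neumann Green's function `G_I(x, x')` of the unit ball, with source point `x'` on
the unit sphere. -/
def interiorGreen (x : Space3) (x' : UnitSphere) : ℝ :=
  2 / ‖x - (x' : Space3)‖
    + Real.log (2 / (1 - inner ℝ x (x' : Space3) + ‖x - (x' : Space3)‖))

/-- The single layer potential `x ↦ ∫_Γ G_I(x, x') σ(x') dS(x')`. -/
def singleLayer (Γ : Set UnitSphere) (σ : UnitSphere → ℝ) (x : Space3) : ℝ :=
  ∫ x' in Γ, interiorGreen x x' * σ x' ∂surfaceMeasure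

/-- The total `I_σ = ∫_Γ σ dS` of a density. -/
def totalDensity (Γ : Set UnitSphere) (σ : UnitSphere → ℝ) : ℝ :=
  ∫ x' in Γ, σ x' ∂surfaceMeasure

/-- The reflecting boundary `Γ_R = ∂Ω \ Γ_A`. -/
def reflecting (ΓA : Set UnitSphere) : Set UnitSphere := ΓAᶜ

/-- `HasOutwardNormalDeriv v D x`: the outward normal derivative `∂v/∂n` at the point `x` of the
unit sphere exists and equals `D`. The outward unit normal at `x` is `x` itself, and the
derivative is one-sided, taken from inside the ball (`t ≤ 0`). -/
def HasOutwardNormalDeriv (v : Space3 → ℝ) (D : ℝ) (x : UnitSphere) : Prop :=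
  HasDerivWithinAt (fun t : ℝ => v ((x : Space3) + t • (x : Space3))) D (Iic 0) 0

/-- `v` is a classical solution of the mixed problem `Δv = 0` in `Ω`, `v = 1` on `Γ_A`,
`∂v/∂n = D` on `Γ_R`. It is continuous up to the boundary except possibly at the interface between
`Γ_A` and `Γ_R`, and the Neumann condition is imposed at the relatively interior points of `Γ_R`. -/
structure SolvesMixedProblem (ΓA : Set UnitSphere) (D : ℝ) (v : Space3 → ℝ) : Prop where
  harmonic : InnerProductSpace.HarmonicOnNhd v (ball 0 1)
  continuousOn : ContinuousOn v
    (ball 0 1 ∪ (fun x : UnitSphere => (x : Space3)) '' (ΓA ∪ interior (reflecting ΓA)))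
  dirichlet : ∀ x ∈ ΓA, v x = 1
  neumann : ∀ x ∈ interior (reflecting ΓA), HasOutwardNormalDeriv v D x

end

noncomputable section

open Filter Topology
open scoped Pointwise

/-! Write s = |x - y| and q = 1 - x·y + s. For |y| = 1 both 2/s and log(2/q) are harmonic in x,
because Δq = 2/s and |∇q|² = 2q/s; differentiating twice under the integral makes v harmonic for any
integrable density. Along a radius, ∂G/∂ρ = (P - 1)/ρ with P = (1 - ρ²)/s³. Since P vanishes at ρ =
1 off the pole, the normal derivative at a point away from the support of the density is minus the
total mass. Continuity at the sphere rests on 0 ≤ G ≤ 4/s and on caps of radius ρ having area O(ρ²):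
the part of G above level N then has mass O(1/N), uniformly in x, so bounded densities have
potentials continuous on the closed ball. Locally bounded densities are split into a near and a far
part.

For I_σ ≠ 0, suppose I_σ = 0. Formally v would have zero flux on Γ_R and equal 1 on Γ_A, hence v ≡
1, against v(0) = 2 I_σ = 0. But σ is only integrable near the edge of Γ_A, so v need not extend
continuously to the closed ball, and no maximum principle applies to it directly. Instead the
positive part of σ is truncated at a height n (density a), and the negative part is restricted to a
compact K ⊆ Γ_A and increased slightly on a compact set of positive measure (density b). Then a has
strictly less mass than b, while the difference of potentials stays above 1/2 on K.
`exists_potential_sub_lt` excludes this: at a minimum of that continuous difference, minus δ|z|², an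
interior point contradicts the Laplacian, a sphere point off K contradicts the radial derivative,
and a point of K contradicts the negative value at the origin. The radial bound for a, whose support
may contain the minimum point, comes from P ≥ 0 (`interiorGreen_smul_le`). -/

/-- The potential of a density on the whole sphere. -/
def potential (f : UnitSphere → ℝ) (x : Space3) : ℝ :=
  ∫ y, interiorGreen x y * f y ∂surfaceMeasure

instance : IsFiniteMeasure surfaceMeasure :=
  inferInstanceAs (IsFiniteMeasure (volume : Measure Space3).toSphere)

lemma singleLayer_eq_potential {Γ : Set UnitSphere} (hΓ : MeasurableSet Γ) (σ : UnitSphere → ℝ)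
    (x : Space3) : singleLayer Γ σ x = potential (Γ.indicator σ) x := by
  unfold singleLayer potential
  rw [← integral_indicator hΓ]
  congr 1 with y
  by_cases hy : y ∈ Γ <;> simp [hy]

/-! ### Elementary bounds on the Green's function -/

lemma norm_unitSphere (y : UnitSphere) : ‖(y : Space3)‖ = 1 := by
  simp

lemma inner_le_norm_unitSphere (x : Space3) (y : UnitSphere) : inner ℝ x (y : Space3) ≤ ‖x‖ := by
  simpa [norm_unitSphere] using real_inner_le_norm x (y : Space3)

lemma neg_norm_le_inner_unitSphere (x : Space3) (y : UnitSphere) :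
    -‖x‖ ≤ inner ℝ x (y : Space3) := by
  have := abs_real_inner_le_norm x (y : Space3)
  rw [norm_unitSphere, mul_one] at this
  exact neg_le_of_abs_le this

/-- The argument of the logarithm in the Green's function is `2 / logArg x y`. -/
def logArg (x : Space3) (y : UnitSphere) : ℝ :=
  1 - inner ℝ x (y : Space3) + ‖x - (y : Space3)‖

lemma interiorGreen_eq (x : Space3) (y : UnitSphere) :
    interiorGreen x y = 2 / ‖x - (y : Space3)‖ + Real.log (2 / logArg x y) := rfl

lemma norm_sub_pos_of_ne {x : Space3} {y : UnitSphere} (h : x ≠ y) : 0 < ‖x - (y : Space3)‖ :=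
  norm_pos_iff.2 (sub_ne_zero.2 h)

lemma norm_sub_le_logArg {x : Space3} (hx : ‖x‖ ≤ 1) (y : UnitSphere) :
    ‖x - (y : Space3)‖ ≤ logArg x y := by
  have := inner_le_norm_unitSphere x y
  unfold logArg; linarith

lemma logArg_le {x : Space3} (hx : ‖x‖ ≤ 1) (y : UnitSphere) : logArg x y ≤ 4 := by
  have h1 := neg_norm_le_inner_unitSphere x y
  have h2 := norm_sub_le x (y : Space3)
  rw [norm_unitSphere] at h2
  unfold logArg; linarith

lemma logArg_pos {x : Space3} (hx : ‖x‖ ≤ 1) {y : UnitSphere} (h : x ≠ y) : 0 < logArg x y :=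
  (norm_sub_pos_of_ne h).trans_le (norm_sub_le_logArg hx y)

/-- In the closed ball s ≤ 2 gives 2/s ≥ 1, while q ≤ 4 keeps the logarithm above -log 2 > -1. -/
lemma interiorGreen_nonneg {x : Space3} (hx : ‖x‖ ≤ 1) (y : UnitSphere) :
    0 ≤ interiorGreen x y := by
  rw [interiorGreen_eq]
  by_cases h : x = y
  -- At the pole the conventions 2/0 = 0 and log 0 = 0 make the Green's function equal to 0.
  · have h0 : logArg x y = 0 := by
      unfold logArg; rw [h, real_inner_self_eq_norm_sq, norm_unitSphere]; simp
    rw [h0, h]; simp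
  · have hs := norm_sub_pos_of_ne h
    have hq := logArg_pos hx h
    have h2 := norm_sub_le x (y : Space3)
    rw [norm_unitSphere] at h2
    have h3 : 1 ≤ 2 / ‖x - (y : Space3)‖ := by rw [le_div_iff₀ hs]; linarith
    have h4 : Real.log (1 / 2) ≤ Real.log (2 / logArg x y) := by
      apply Real.log_le_log (by norm_num)
      rw [div_le_div_iff₀ (by norm_num) hq]; linarith [logArg_le hx y]
    have h5 : Real.log (1 / 2) = - Real.log 2 := by rw [one_div, Real.log_inv]
    have := Real.log_two_lt_d9
    linarith

/-- Uses log u ≤ u - 1 with u = 2/q, and q ≥ s in the closed ball. -/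
lemma interiorGreen_le {x : Space3} (hx : ‖x‖ ≤ 1) (y : UnitSphere) :
    interiorGreen x y ≤ 4 / ‖x - (y : Space3)‖ := by
  rw [interiorGreen_eq]
  by_cases h : x = y
  · have h0 : logArg x y = 0 := by
      unfold logArg; rw [h, real_inner_self_eq_norm_sq, norm_unitSphere]; simp
    rw [h0, h]; simp
  · have hs := norm_sub_pos_of_ne h
    have hq := logArg_pos hx h
    have h1 : Real.log (2 / logArg x y) ≤ 2 / logArg x y - 1 := Real.log_le_sub_one_of_pos (by positivity)
    have h2 : 2 / logArg x y ≤ 2 / ‖x - (y : Space3)‖ :=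
      div_le_div_of_nonneg_left (by norm_num) hs (norm_sub_le_logArg hx y)
    have h3 : 4 / ‖x - (y : Space3)‖ = 2 / ‖x - (y : Space3)‖ + 2 / ‖x - (y : Space3)‖ := by ring
    linarith

lemma interiorGreen_zero (y : UnitSphere) : interiorGreen 0 y = 2 := by
  rw [interiorGreen_eq]; simp [logArg]; norm_num

lemma potential_zero (f : UnitSphere → ℝ) : potential f 0 = 2 * ∫ y, f y ∂surfaceMeasure := by
  simp only [potential, interiorGreen_zero, integral_const_mul]

lemma measurable_interiorGreen (x : Space3) : Measurable (interiorGreen x) := by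
  unfold interiorGreen
  have h1 : Measurable fun y : UnitSphere => ‖x - (y : Space3)‖ :=
    (continuous_const.sub continuous_subtype_val).norm.measurable
  have h2 : Measurable fun y : UnitSphere => (inner ℝ x (y : Space3) : ℝ) :=
    (continuous_const.inner continuous_subtype_val).measurable
  exact (measurable_const.div h1).add
    (Real.measurable_log.comp (measurable_const.div ((measurable_const.sub h2).add h1)))

lemma continuousAt_interiorGreen {x : Space3} (hx : ‖x‖ ≤ 1) {y : UnitSphere} (h : x ≠ y) :
    ContinuousAt (fun z => interiorGreen z y) x := by
  have hs := norm_sub_pos_of_ne h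
  have hq := logArg_pos hx h
  unfold logArg at hq
  unfold interiorGreen
  have c1 : ContinuousAt (fun z : Space3 => ‖z - (y : Space3)‖) x := by fun_prop
  have c2 : ContinuousAt (fun z : Space3 => (inner ℝ z (y : Space3) : ℝ)) x := by fun_prop
  refine (continuousAt_const.div c1 hs.ne').add (ContinuousAt.log ?_ (by positivity))
  exact continuousAt_const.div ((continuousAt_const.sub c2).add c1) hq.ne'

/-! ### Small caps -/

/-- The surface measure of a cap is three times the volume of the cone over it. That cone lies in a
tube of width O(ρ) about the segment from 0 to x, covered by O(1/ρ) balls of volume O(ρ³). The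
centre x need not lie on the sphere, which makes later estimates uniform up to the boundary. -/
lemma exists_surfaceMeasure_cap_le : ∃ C : ℝ, 0 < C ∧ ∀ x : Space3, ‖x‖ ≤ 1 → ∀ ρ : ℝ, 0 < ρ → ρ ≤ 1 →
    surfaceMeasure {y : UnitSphere | ‖x - (y : Space3)‖ < ρ} ≤ ENNReal.ofReal (C * ρ ^ 2) := by
  set V : ℝ := (volume : Measure Space3).real (ball 0 1) with hV
  have hVpos : 0 < V := by
    rw [hV, measureReal_def]
    exact ENNReal.toReal_pos (measure_ball_pos _ _ one_pos).ne' measure_ball_lt_top.ne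
  refine ⟨72 * V, by positivity, fun x hx ρ hρ hρ1 => ?_⟩
  have hmeas : MeasurableSet {y : UnitSphere | ‖x - (y : Space3)‖ < ρ} :=
    (isOpen_lt (continuous_const.sub continuous_subtype_val).norm continuous_const).measurableSet
  unfold surfaceMeasure
  rw [Measure.toSphere_apply' _ hmeas]
  set N : ℕ := ⌊1 / ρ⌋₊ + 1
  have hcover : (Ioo (0 : ℝ) 1) • (Subtype.val '' {y : UnitSphere | ‖x - (y : Space3)‖ < ρ}) ⊆
      ⋃ k ∈ Finset.range N, ball (((k : ℝ) * ρ) • x) (2 * ρ) := by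
    rintro _ ⟨t, ht, _, ⟨y, hy, rfl⟩, rfl⟩
    simp only [mem_ofPred_eq] at hy
    simp only [mem_iUnion, Finset.mem_range]
    -- For a point t • y of the cone, take the largest multiple kρ ≤ t: the cap costs less than ρ
    -- and the rounding at most ρ, whence the radius 2ρ.
    refine ⟨⌊t / ρ⌋₊, ?_, ?_⟩
    · exact Nat.lt_succ_of_le (Nat.floor_mono (by gcongr; exact ht.2.le))
    · have h0 : 0 ≤ t / ρ := div_nonneg ht.1.le hρ.le
      have h1 := Nat.floor_le h0
      have h2 := Nat.lt_floor_add_one (t / ρ)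
      set k : ℝ := (⌊t / ρ⌋₊ : ℝ)
      rw [le_div_iff₀ hρ] at h1
      rw [div_lt_iff₀ hρ] at h2
      rw [mem_ball, dist_eq_norm]
      have e : t • (y : Space3) - (k * ρ) • x = t • ((y : Space3) - x) + (t - k * ρ) • x := by
        module
      have e' : ‖t • ((y : Space3) - x)‖ < ρ := by
        rw [norm_smul, Real.norm_of_nonneg ht.1.le, norm_sub_rev]
        nlinarith [ht.2, ht.1, norm_nonneg (x - (y : Space3))]
      have e'' : ‖(t - k * ρ) • x‖ ≤ ρ := by
        rw [norm_smul, Real.norm_of_nonneg (by linarith)]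
        nlinarith [norm_nonneg x]
      show ‖t • (y : Space3) - (k * ρ) • x‖ < _
      rw [e]
      linarith [norm_add_le (t • ((y : Space3) - x)) ((t - k * ρ) • x)]
  have hball : ∀ z : Space3, volume (ball z (2 * ρ)) = ENNReal.ofReal (8 * ρ ^ 3 * V) := by
    intro z
    rw [Measure.addHaar_ball _ _ (by positivity)]
    simp only [finrank_euclideanSpace, Fintype.card_fin]
    rw [ENNReal.ofReal_mul (by positivity), hV, ofReal_measureReal measure_ball_lt_top.ne]
    congr 2; ring
  have hN : (N : ℝ) * ρ ≤ 3 := by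
    have := Nat.floor_le (show (0 : ℝ) ≤ 1 / ρ by positivity)
    rw [le_div_iff₀ hρ] at this
    simp only [N]; push_cast; nlinarith
  have hvol : volume ((Ioo (0 : ℝ) 1) • (Subtype.val '' {y : UnitSphere | ‖x - (y : Space3)‖ < ρ})) ≤
      ENNReal.ofReal (24 * V * ρ ^ 2) := by
    refine (measure_mono hcover).trans ((measure_biUnion_finset_le _ _).trans ?_)
    simp only [hball, Finset.sum_const, Finset.card_range, nsmul_eq_mul]
    rw [← ENNReal.ofReal_natCast, ← ENNReal.ofReal_mul (by positivity)]
    apply ENNReal.ofReal_le_ofReal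
    have : (N : ℝ) * (8 * ρ ^ 3 * V) = (N * ρ) * (8 * ρ ^ 2 * V) := by ring
    rw [this]
    nlinarith [mul_le_mul_of_nonneg_right hN (show 0 ≤ 8 * ρ ^ 2 * V by positivity)]
  have hdim : Module.finrank ℝ Space3 = 3 := by simp
  rw [hdim]
  calc _ ≤ ((3 : ℕ) : ENNReal) * ENNReal.ofReal (24 * V * ρ ^ 2) := by gcongr
    _ = ENNReal.ofReal (72 * V * ρ ^ 2) := by
      rw [← ENNReal.ofReal_natCast, ← ENNReal.ofReal_mul (by positivity)]
      congr 1; push_cast; ring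

lemma ae_ne_unitSphere {x : Space3} (hx : ‖x‖ ≤ 1) : ∀ᵐ y : UnitSphere ∂surfaceMeasure, x ≠ y := by
  obtain ⟨C, hC, h⟩ := exists_surfaceMeasure_cap_le
  have hset : {y : UnitSphere | ¬ x ≠ y} ⊆ {y | x = y} := fun y hy => by simpa using hy
  rw [ae_iff]
  refine measure_mono_null hset ?_
  have hle : ∀ ρ ∈ Ioc (0 : ℝ) 1, surfaceMeasure {y : UnitSphere | x = y} ≤ ENNReal.ofReal (C * ρ ^ 2) :=
    fun ρ hρ => (measure_mono (t := {y : UnitSphere | ‖x - (y : Space3)‖ < ρ})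
      (fun y (hy : x = (y : Space3)) => by
      simpa [← hy] using hρ.1)).trans (h x hx ρ hρ.1 hρ.2)
  have ht : Tendsto (fun ρ : ℝ => ENNReal.ofReal (C * ρ ^ 2)) (𝓝[>] 0) (𝓝 0) := by
    have : Continuous fun ρ : ℝ => ENNReal.ofReal (C * ρ ^ 2) :=
      ENNReal.continuous_ofReal.comp (by fun_prop)
    simpa using (this.tendsto 0).mono_left nhdsWithin_le_nhds
  refine le_antisymm (ge_of_tendsto ht ?_) bot_le
  filter_upwards [Ioc_mem_nhdsGT (zero_lt_one' ℝ)] with ρ hρ using hle ρ hρ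

/-- The mass of the part of the Green's function above the level `N` is `O(1 / N)`, uniformly. -/
lemma exists_lintegral_green_sub_le : ∃ C : ℝ, 0 < C ∧ ∀ x : Space3, ‖x‖ ≤ 1 → ∀ N : ℝ, 4 ≤ N →
    ∫⁻ y, ENNReal.ofReal (max (interiorGreen x y - N) 0) ∂surfaceMeasure ≤ ENNReal.ofReal (C / N) := by
  obtain ⟨C, hC, h⟩ := exists_surfaceMeasure_cap_le
  refine ⟨16 * C, by positivity, fun x hx N hN => ?_⟩
  have hNpos : 0 < N := by linarith
  -- Layer-cake formula: {G > N + t} lies in the cap of radius 4/(N + t), which is at most 1 because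
  -- N ≥ 4. Its measure is at most 16C/(N + t)², and integrating over t > 0 gives 16C/N.
  rw [lintegral_eq_lintegral_meas_lt surfaceMeasure
    (f := fun y => max (interiorGreen x y - N) 0) (ae_of_all _ fun y => le_max_right _ _)
    (((measurable_interiorGreen x).sub_const N).max measurable_const).aemeasurable]
  have hbound : ∀ t ∈ Ioi (0 : ℝ), surfaceMeasure {y | t < max (interiorGreen x y - N) 0} ≤
      ENNReal.ofReal (16 * C * ((N + t) ^ 2)⁻¹) := by
    intro t ht
    have ht : 0 < t := ht
    have hNt : 0 < N + t := by linarith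
    refine (measure_mono (fun y hy => ?_)).trans ((h x hx (4 / (N + t)) (by positivity)
      (by rw [div_le_one hNt]; linarith)).trans_eq ?_)
    · simp only [mem_ofPred_eq, lt_max_iff] at hy ⊢
      have hy : N + t < interiorGreen x y := by rcases hy with hy | hy <;> linarith
      have h1 := hy.trans_le (interiorGreen_le hx y)
      have hs : 0 < ‖x - (y : Space3)‖ := by
        rcases (norm_nonneg (x - (y : Space3))).eq_or_lt with h0 | h0
        · rw [← h0] at h1; simp at h1; linarith
        · exact h0
      rw [lt_div_iff₀ hs] at h1
      rw [lt_div_iff₀ hNt]; linarith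
    · congr 1; field_simp; ring
  refine (setLIntegral_mono' measurableSet_Ioi hbound).trans ?_
  have hderiv : ∀ t ∈ Ioi (0 : ℝ), HasDerivAt (fun t => -(16 * C * (N + t)⁻¹)) (16 * C * ((N + t) ^ 2)⁻¹) t := by
    intro t ht
    have ht : 0 < t := ht
    have hd := (((hasDerivAt_id t).const_add N).inv (by simp; linarith)).const_mul (16 * C) |>.neg
    refine hd.congr_deriv ?_
    simp [div_eq_mul_inv]
  have hcont : ContinuousWithinAt (fun t : ℝ => -(16 * C * (N + t)⁻¹)) (Ici 0) 0 := by
    apply ContinuousAt.continuousWithinAt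
    have : N + (0 : ℝ) ≠ 0 := by linarith
    fun_prop (disch := assumption)
  have hlim : Tendsto (fun t : ℝ => -(16 * C * (N + t)⁻¹)) atTop (𝓝 0) := by
    have := (tendsto_inv_atTop_zero.comp (tendsto_atTop_add_const_left atTop N tendsto_id)).const_mul (16 * C) |>.neg
    simpa using this
  have hpos : ∀ t ∈ Ioi (0 : ℝ), 0 ≤ 16 * C * ((N + t) ^ 2)⁻¹ := fun t _ => by positivity
  have hI := integrableOn_Ioi_deriv_of_nonneg hcont hderiv hpos hlim
  have hE := integral_Ioi_of_hasDerivAt_of_nonneg hcont hderiv hpos hlim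
  rw [← ofReal_integral_eq_lintegral_ofReal hI ((ae_restrict_iff' measurableSet_Ioi).2 (ae_of_all _ hpos)), hE]
  apply ENNReal.ofReal_le_ofReal
  simp [div_eq_mul_inv]

lemma integrable_green_sub {x : Space3} (hx : ‖x‖ ≤ 1) {N : ℝ} (hN : 4 ≤ N) :
    Integrable (fun y => max (interiorGreen x y - N) 0) surfaceMeasure := by
  obtain ⟨C, -, h⟩ := exists_lintegral_green_sub_le
  refine ⟨(((measurable_interiorGreen x).sub_const N).max measurable_const).aestronglyMeasurable, ?_⟩
  rw [hasFiniteIntegral_iff_ofReal (f := fun y => max (interiorGreen x y - N) 0) (ae_of_all _ fun y => le_max_right _ _)]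
  exact (h x hx N hN).trans_lt ENNReal.ofReal_lt_top

lemma exists_integral_green_sub_le : ∃ C : ℝ, 0 < C ∧ ∀ x : Space3, ‖x‖ ≤ 1 → ∀ N : ℝ, 4 ≤ N →
    ∫ y, max (interiorGreen x y - N) 0 ∂surfaceMeasure ≤ C / N := by
  obtain ⟨C, hC, h⟩ := exists_lintegral_green_sub_le
  refine ⟨C, hC, fun x hx N hN => ?_⟩
  rw [integral_eq_lintegral_of_nonneg_ae (f := fun y => max (interiorGreen x y - N) 0) (ae_of_all _ fun y => le_max_right _ _)
    (((measurable_interiorGreen x).sub_const N).max measurable_const).aestronglyMeasurable]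
  exact ENNReal.toReal_le_of_le_ofReal (div_nonneg hC.le (by linarith)) (h x hx N hN)

lemma integrable_green {x : Space3} (hx : ‖x‖ ≤ 1) :
    Integrable (interiorGreen x) surfaceMeasure := by
  refine ((integrable_const (4 : ℝ)).add (integrable_green_sub hx le_rfl)).mono'
    (measurable_interiorGreen x).aestronglyMeasurable (ae_of_all _ fun y => ?_)
  rw [Real.norm_of_nonneg (interiorGreen_nonneg hx y)]
  have := le_max_left (interiorGreen x y - 4) 0
  simp only [Pi.add_apply]; linarith

lemma exists_integral_green_le : ∃ C : ℝ, 0 < C ∧ ∀ x : Space3, ‖x‖ ≤ 1 →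
    ∫ y, interiorGreen x y ∂surfaceMeasure ≤ C := by
  obtain ⟨C, hC, h⟩ := exists_integral_green_sub_le
  refine ⟨4 * surfaceMeasure.real univ + C / 4, by positivity, fun x hx => ?_⟩
  calc ∫ y, interiorGreen x y ∂surfaceMeasure
      ≤ ∫ y, (4 + max (interiorGreen x y - 4) 0) ∂surfaceMeasure := by
        refine integral_mono (integrable_green hx)
          ((integrable_const _).add (integrable_green_sub hx le_rfl)) fun y => ?_
        have := le_max_left (interiorGreen x y - 4) 0
        simp only; linarith
    _ = 4 * surfaceMeasure.real univ + ∫ y, max (interiorGreen x y - 4) 0 ∂surfaceMeasure := by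
        rw [integral_add (integrable_const _) (integrable_green_sub hx le_rfl)]
        simp [mul_comm]
    _ ≤ _ := by gcongr; exact h x hx 4 le_rfl

/-! ### Continuity of potentials up to the sphere -/

lemma integrable_green_mul_of_bounded {f : UnitSphere → ℝ} (hf : Integrable f surfaceMeasure) {M : ℝ}
    (hM : ∀ y, |f y| ≤ M) {x : Space3} (hx : ‖x‖ ≤ 1) :
    Integrable (fun y => interiorGreen x y * f y) surfaceMeasure :=
  (integrable_green hx).mul_bdd hf.1 (ae_of_all _ hM)

/-- Cutting the kernel at height N gives a bounded kernel, whose potential is continuous by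
dominated convergence. The remainder is at most M C/N uniformly on the closed ball, so the potential
is a uniform limit of continuous functions. -/
lemma continuousOn_potential_of_bounded {f : UnitSphere → ℝ} (hf : Integrable f surfaceMeasure) {M : ℝ}
    (hM : ∀ y, |f y| ≤ M) : ContinuousOn (potential f) (closedBall 0 1) := by
  obtain ⟨C, hC, h⟩ := exists_integral_green_sub_le
  have hM0 : 0 ≤ M := (abs_nonneg _).trans (hM ⟨EuclideanSpace.single 0 1, by simp⟩)
  have hsplit : ∀ N : ℕ, ∀ x y, interiorGreen x y =
      min (interiorGreen x y) N + max (interiorGreen x y - N) 0 := by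
    intro N x y
    rcases le_total (interiorGreen x y) N with h | h
    · rw [min_eq_left h, max_eq_right (by linarith)]; ring
    · rw [min_eq_right h, max_eq_left (by linarith)]; ring
  have hcont : ∀ N : ℕ, ContinuousOn
      (fun x => ∫ y, min (interiorGreen x y) N * f y ∂surfaceMeasure) (closedBall 0 1) := by
    intro N x hx
    have hx' : ‖x‖ ≤ 1 := by simpa using hx
    refine continuousWithinAt_of_dominated (bound := fun y => N * |f y|) ?_ ?_
      (hf.abs.const_mul _) ?_
    · exact Eventually.of_forall fun z =>
        ((measurable_interiorGreen z).min measurable_const).aestronglyMeasurable.mul hf.1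
    · filter_upwards [self_mem_nhdsWithin] with z hz
      refine ae_of_all _ fun y => ?_
      have h0 := interiorGreen_nonneg (show ‖z‖ ≤ 1 by simpa using hz) y
      rw [norm_mul, Real.norm_of_nonneg (le_min h0 (Nat.cast_nonneg _)), Real.norm_eq_abs]
      gcongr
      exact min_le_right _ _
    · filter_upwards [ae_ne_unitSphere hx'] with y hy
      have hc := continuousAt_interiorGreen hx' hy
      exact ((hc.continuousWithinAt.min continuousWithinAt_const).mul continuousWithinAt_const)
  have hunif : TendstoUniformlyOn
      (fun (N : ℕ) x => ∫ y, min (interiorGreen x y) N * f y ∂surfaceMeasure) (potential f)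
      atTop (closedBall 0 1) := by
    rw [Metric.tendstoUniformlyOn_iff]
    intro ε hε
    have hlim : Tendsto (fun N : ℕ => M * (C / N)) atTop (𝓝 0) := by
      simpa using (tendsto_const_div_atTop_nhds_zero_nat C).const_mul M
    filter_upwards [hlim.eventually_lt_const hε, eventually_ge_atTop 4] with N hN hN4 x hx
    have hx' : ‖x‖ ≤ 1 := by simpa using hx
    have hN4' : (4 : ℝ) ≤ N := by exact_mod_cast hN4
    refine lt_of_le_of_lt ?_ hN
    have hi := (integrable_green_sub hx' hN4').mul_bdd hf.1 (ae_of_all _ hM)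
    have hi2 : Integrable (fun y => min (interiorGreen x y) N * f y) surfaceMeasure := by
      refine ((integrable_green_mul_of_bounded hf hM hx').sub hi).congr (ae_of_all _ fun y => ?_)
      simp only [Pi.sub_apply]
      nth_rewrite 1 [hsplit N x y]; ring
    have : potential f x - ∫ y, min (interiorGreen x y) N * f y ∂surfaceMeasure =
        ∫ y, max (interiorGreen x y - N) 0 * f y ∂surfaceMeasure := by
      unfold potential
      rw [← integral_sub (integrable_green_mul_of_bounded hf hM hx') hi2]
      congr 1 with y
      nth_rewrite 1 [hsplit N x y]; ring
    rw [Real.dist_eq, this]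
    calc |∫ y, max (interiorGreen x y - N) 0 * f y ∂surfaceMeasure|
        ≤ ∫ y, M * max (interiorGreen x y - N) 0 ∂surfaceMeasure := by
          rw [← Real.norm_eq_abs]
          refine norm_integral_le_of_norm_le ((integrable_green_sub hx' hN4').const_mul M)
            (ae_of_all _ fun y => ?_)
          rw [norm_mul, Real.norm_of_nonneg (le_max_right _ _), mul_comm]
          gcongr
          exact hM y
      _ ≤ M * (C / N) := by
          rw [integral_const_mul]; gcongr; exact h x hx' N hN4'
  exact hunif.continuousOn (Eventually.of_forall hcont).frequently

/-- If the density vanishes near `x₀`, the potential is a proper integral near `x₀`. -/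
lemma norm_green_mul_le {f : UnitSphere → ℝ} {x₀ : Space3} {r : ℝ} (hr : 0 < r)
    (hf0 : ∀ y : UnitSphere, ‖x₀ - y‖ < r → f y = 0) {x : Space3} (hx : ‖x‖ ≤ 1)
    (hxx : ‖x - x₀‖ ≤ r / 2) (y : UnitSphere) :
    ‖interiorGreen x y * f y‖ ≤ 8 / r * |f y| := by
  rcases lt_or_ge ‖x₀ - (y : Space3)‖ r with h | h
  · simp [hf0 y h]
  · rw [norm_mul, Real.norm_of_nonneg (interiorGreen_nonneg hx y), Real.norm_eq_abs]
    gcongr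
    have h1 : r / 2 ≤ ‖x - (y : Space3)‖ := by
      have := norm_sub_le_norm_sub_add_norm_sub x₀ x (y : Space3)
      rw [norm_sub_rev x₀ x] at this
      linarith
    calc _ ≤ _ := interiorGreen_le hx y
      _ ≤ 4 / (r / 2) := by gcongr
      _ = 8 / r := by field_simp; norm_num

lemma integrable_green_mul_of_vanishing {f : UnitSphere → ℝ} (hf : Integrable f surfaceMeasure)
    {x₀ : Space3} {r : ℝ} (hr : 0 < r) (hf0 : ∀ y : UnitSphere, ‖x₀ - y‖ < r → f y = 0)
    {x : Space3} (hx : ‖x‖ ≤ 1) (hxx : ‖x - x₀‖ ≤ r / 2) :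
    Integrable (fun y => interiorGreen x y * f y) surfaceMeasure :=
  (hf.abs.const_mul (8 / r)).mono' ((measurable_interiorGreen x).aestronglyMeasurable.mul hf.1)
    (ae_of_all _ (norm_green_mul_le hr hf0 hx hxx))

lemma continuousWithinAt_potential_of_vanishing {f : UnitSphere → ℝ}
    (hf : Integrable f surfaceMeasure) {x₀ : Space3} (hx₀ : ‖x₀‖ ≤ 1) {r : ℝ} (hr : 0 < r)
    (hf0 : ∀ y : UnitSphere, ‖x₀ - y‖ < r → f y = 0) :
    ContinuousWithinAt (potential f) (closedBall 0 1) x₀ := by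
  refine continuousWithinAt_of_dominated (bound := fun y => 8 / r * |f y|) ?_ ?_
    (hf.abs.const_mul _) ?_
  · exact Eventually.of_forall fun z => (measurable_interiorGreen z).aestronglyMeasurable.mul hf.1
  · filter_upwards [self_mem_nhdsWithin, mem_nhdsWithin_of_mem_nhds
      (closedBall_mem_nhds x₀ (half_pos hr))] with z hz hz'
    exact ae_of_all _ (norm_green_mul_le hr hf0 (by simpa using hz) (by simpa [dist_eq_norm] using hz'))
  · filter_upwards [ae_ne_unitSphere hx₀] with y hy
    exact ((continuousAt_interiorGreen hx₀ hy).mul continuousAt_const).continuousWithinAt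

section LocallyBounded

variable {f : UnitSphere → ℝ} {x₀ : Space3} {r M : ℝ}

lemma integrable_near_and_far (hf : Integrable f surfaceMeasure) (x₀ : Space3) (r : ℝ) :
    Integrable ({y : UnitSphere | ‖x₀ - y‖ < r}.indicator f) surfaceMeasure ∧
      Integrable ({y : UnitSphere | ‖x₀ - y‖ < r}ᶜ.indicator f) surfaceMeasure := by
  have hm : MeasurableSet {y : UnitSphere | ‖x₀ - y‖ < r} :=
    (isOpen_lt (continuous_const.sub continuous_subtype_val).norm continuous_const).measurableSet
  exact ⟨hf.indicator hm, hf.indicator hm.compl⟩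

lemma abs_indicator_near_le (hM : ∀ y : UnitSphere, ‖x₀ - y‖ < r → |f y| ≤ M) (y : UnitSphere) :
    |{y : UnitSphere | ‖x₀ - y‖ < r}.indicator f y| ≤ max M 0 := by
  by_cases h : ‖x₀ - (y : Space3)‖ < r
  · rw [indicator_of_mem (by exact h)]; exact (hM y h).trans (le_max_left _ _)
  · rw [indicator_of_notMem (by exact h)]; simp

lemma indicator_far_eq_zero (y : UnitSphere) (h : ‖x₀ - (y : Space3)‖ < r) :
    {y : UnitSphere | ‖x₀ - y‖ < r}ᶜ.indicator f y = 0 :=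
  indicator_of_notMem (by simpa using h) _

lemma green_mul_eq_near_add_far (x : Space3) (y : UnitSphere) : interiorGreen x y * f y =
    interiorGreen x y * {y : UnitSphere | ‖x₀ - y‖ < r}.indicator f y +
      interiorGreen x y * {y : UnitSphere | ‖x₀ - y‖ < r}ᶜ.indicator f y := by
  rw [← mul_add, indicator_self_add_compl_apply]

lemma integrable_green_mul_of_locallyBounded (hf : Integrable f surfaceMeasure) (hr : 0 < r)
    (hM : ∀ y : UnitSphere, ‖x₀ - y‖ < r → |f y| ≤ M) {x : Space3} (hx : ‖x‖ ≤ 1)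
    (hxx : ‖x - x₀‖ ≤ r / 2) : Integrable (fun y => interiorGreen x y * f y) surfaceMeasure := by
  obtain ⟨h1, h2⟩ := integrable_near_and_far hf x₀ r
  exact ((integrable_green_mul_of_bounded h1 (abs_indicator_near_le hM) hx).add
    (integrable_green_mul_of_vanishing h2 hr indicator_far_eq_zero hx hxx)).congr
    (ae_of_all _ fun y => (green_mul_eq_near_add_far x y).symm)

/-- The density splits into a bounded part near x₀ and an integrable part vanishing near x₀; the
kernel is bounded on the support of the latter for x close to x₀. -/
lemma continuousWithinAt_potential_of_locallyBounded (hf : Integrable f surfaceMeasure) (hr : 0 < r)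
    (hM : ∀ y : UnitSphere, ‖x₀ - y‖ < r → |f y| ≤ M) (hx₀ : ‖x₀‖ ≤ 1) :
    ContinuousWithinAt (potential f) (closedBall 0 1) x₀ := by
  obtain ⟨h1, h2⟩ := integrable_near_and_far hf x₀ r
  have hc := (continuousOn_potential_of_bounded h1 (abs_indicator_near_le hM) x₀
    (by simpa using hx₀)).add
    (continuousWithinAt_potential_of_vanishing h2 hx₀ hr indicator_far_eq_zero)
  have heq : ∀ x : Space3, ‖x‖ ≤ 1 → ‖x - x₀‖ ≤ r / 2 → potential f x =
      potential ({y : UnitSphere | ‖x₀ - y‖ < r}.indicator f) x +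
        potential ({y : UnitSphere | ‖x₀ - y‖ < r}ᶜ.indicator f) x := by
    intro x hx hxx
    unfold potential
    rw [← integral_add (integrable_green_mul_of_bounded h1 (abs_indicator_near_le hM) hx)
      (integrable_green_mul_of_vanishing h2 hr indicator_far_eq_zero hx hxx)]
    exact integral_congr_ae (ae_of_all _ fun y => green_mul_eq_near_add_far x y)
  refine hc.congr_of_eventuallyEq ?_ (heq x₀ hx₀ (by simp; positivity))
  filter_upwards [self_mem_nhdsWithin, mem_nhdsWithin_of_mem_nhds
      (closedBall_mem_nhds x₀ (half_pos hr))] with z hz hz'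
  exact heq z (by simpa using hz) (by simpa [dist_eq_norm] using hz')

end LocallyBounded

/-! ### Integrals over a compact space depending on a parameter -/

section Parametric

variable {E F Y : Type*} [NormedAddCommGroup E] [NormedAddCommGroup F] [TopologicalSpace Y]
  {f : Y → ℝ} {U : Set E}

lemma continuous_slice {H : E → Y → F}
    (hH : ContinuousOn (fun p : E × Y => H p.1 p.2) (U ×ˢ univ)) {x : E} (hx : x ∈ U) :
    Continuous (H x) :=
  hH.comp_continuous (f := fun y => (x, y)) (by fun_prop) fun y => ⟨hx, mem_univ y⟩

variable [ProperSpace E] [CompactSpace Y]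

/-- Compactness of Y makes the bound uniform in y, so a constant multiple of |f| dominates the
integrands below for any integrable f. -/
lemma exists_bound_near {H : E → Y → F} (hU : IsOpen U)
    (hH : ContinuousOn (fun p : E × Y => H p.1 p.2) (U ×ˢ univ)) {x : E} (hx : x ∈ U) :
    ∃ M : ℝ, ∃ s ∈ 𝓝 x, s ⊆ U ∧ ∀ z ∈ s, ∀ y, ‖H z y‖ ≤ M := by
  obtain ⟨r, hr, hrU⟩ := Metric.nhds_basis_closedBall.mem_iff.1 (hU.mem_nhds hx)
  obtain ⟨M, hM⟩ := ((isCompact_closedBall x r).prod (isCompact_univ (X := Y))).exists_bound_of_continuousOn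
    (hH.mono (prod_mono hrU Subset.rfl))
  exact ⟨M, closedBall x r, closedBall_mem_nhds x hr, hrU, fun z hz y => hM (z, y) ⟨hz, mem_univ y⟩⟩

variable [NormedSpace ℝ F] [MeasurableSpace Y] [OpensMeasurableSpace Y]
  [SecondCountableTopologyEither Y F] {μ : Measure Y}

lemma continuousOn_integral_smul {H : E → Y → F} (hU : IsOpen U)
    (hf : Integrable f μ) (hH : ContinuousOn (fun p : E × Y => H p.1 p.2) (U ×ˢ univ)) :
    ContinuousOn (fun x => ∫ y, f y • H x y ∂μ) U := by
  intro x hx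
  obtain ⟨M, s, hs, hsU, hM⟩ := exists_bound_near hU hH hx
  refine (continuousAt_of_dominated (bound := fun y => ‖f y‖ * M) ?_ ?_ (hf.norm.mul_const M)
    ?_).continuousWithinAt
  · filter_upwards [hs] with z hz
    exact hf.1.smul (continuous_slice hH (hsU hz)).aestronglyMeasurable
  · filter_upwards [hs] with z hz
    refine ae_of_all _ fun y => ?_
    rw [norm_smul]
    gcongr
    exact hM z hz y
  · refine ae_of_all _ fun y => continuousAt_const.smul ?_
    have : ContinuousAt (fun p : E × Y => H p.1 p.2) (x, y) :=
      hH.continuousAt ((hU.prod isOpen_univ).mem_nhds ⟨hx, mem_univ y⟩)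
    exact this.comp (f := fun z => (z, y)) (by fun_prop)

lemma integrable_smul_slice {H : E → Y → F} (hU : IsOpen U)
    (hf : Integrable f μ) (hH : ContinuousOn (fun p : E × Y => H p.1 p.2) (U ×ˢ univ)) {x : E}
    (hx : x ∈ U) : Integrable (fun y => f y • H x y) μ := by
  obtain ⟨M, s, hs, hsU, hM⟩ := exists_bound_near hU hH hx
  refine (hf.norm.mul_const M).mono' (hf.1.smul (continuous_slice hH hx).aestronglyMeasurable)
    (ae_of_all _ fun y => ?_)
  rw [norm_smul]
  gcongr
  exact hM x (mem_of_mem_nhds hs) y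

lemma hasFDerivAt_integral_smul [NormedSpace ℝ E] [SecondCountableTopologyEither Y (E →L[ℝ] F)]
    {H : E → Y → F} {H' : E → Y → E →L[ℝ] F} (hU : IsOpen U)
    (hf : Integrable f μ) (hH : ContinuousOn (fun p : E × Y => H p.1 p.2) (U ×ˢ univ))
    (hH' : ContinuousOn (fun p : E × Y => H' p.1 p.2) (U ×ˢ univ))
    (hd : ∀ x ∈ U, ∀ y, HasFDerivAt (fun z => H z y) (H' x y) x) {x : E} (hx : x ∈ U) :
    HasFDerivAt (fun x => ∫ y, f y • H x y ∂μ) (∫ y, f y • H' x y ∂μ) x := by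
  obtain ⟨M, s, hs, hsU, hM⟩ := exists_bound_near hU hH' hx
  refine hasFDerivAt_integral_of_dominated_of_fderiv_le (F' := fun z y => f y • H' z y)
    (bound := fun y => ‖f y‖ * M) hs ?_ (integrable_smul_slice hU hf hH hx)
    (hf.1.smul (continuous_slice hH' hx).aestronglyMeasurable) ?_ (hf.norm.mul_const M) ?_
  · filter_upwards [hs] with z hz
    exact hf.1.smul (continuous_slice hH (hsU hz)).aestronglyMeasurable
  · refine ae_of_all _ fun y z hz => ?_
    rw [norm_smul]
    gcongr
    exact hM z hz y
  · exact ae_of_all _ fun y z hz => (hd z (hsU hz) y).const_smul (f y)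

end Parametric

/-! ### Derivatives of the Green's function -/

/-- The inner product of `Space3` as a continuous bilinear map. -/
def innerL : Space3 →L[ℝ] Space3 →L[ℝ] ℝ :=
  (isBoundedBilinearMap_inner (𝕜 := ℝ) (E := Space3)).toContinuousLinearMap

@[simp] lemma innerL_apply (u h : Space3) : innerL u h = inner ℝ u h := rfl

lemma hasFDerivAt_norm_sub {x y : Space3} (h : x ≠ y) :
    HasFDerivAt (fun z => ‖z - y‖) (‖x - y‖⁻¹ • innerL (x - y)) x := by
  have h0 : ‖x - y‖ ≠ 0 := norm_ne_zero_iff.2 (sub_ne_zero.2 h)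
  have h1 := ((hasFDerivAt_id x).sub_const y).norm_sq.sqrt (pow_ne_zero 2 h0)
  refine (h1.congr_fderiv ?_).congr_of_eventuallyEq (Eventually.of_forall fun z => ?_)
  · ext k
    simp only [id, Real.sqrt_sq (norm_nonneg _)]
    simp
    field_simp
  · simp [Real.sqrt_sq (norm_nonneg _)]

lemma hasFDerivAt_inv_norm_sub {x y : Space3} (h : x ≠ y) :
    HasFDerivAt (fun z => ‖z - y‖⁻¹) (-(‖x - y‖⁻¹ ^ 3) • innerL (x - y)) x := by
  have h0 : ‖x - y‖ ≠ 0 := norm_ne_zero_iff.2 (sub_ne_zero.2 h)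
  refine ((hasDerivAt_inv h0).comp_hasFDerivAt x (hasFDerivAt_norm_sub h)).congr_fderiv ?_
  ext k
  simp
  field_simp

/-- The gradient of `logArg`. -/
def logArgGrad (x : Space3) (y : UnitSphere) : Space3 :=
  ‖x - (y : Space3)‖⁻¹ • (x - y) - y

/-- The derivative of `logArgGrad`. -/
def logArgHess (x : Space3) (y : UnitSphere) : Space3 →L[ℝ] Space3 :=
  ‖x - (y : Space3)‖⁻¹ • ContinuousLinearMap.id ℝ Space3 +
    (-(‖x - (y : Space3)‖⁻¹ ^ 3) • innerL (x - y)).smulRight (x - y)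

/-- The gradient of the Green's function. -/
def greenGrad (x : Space3) (y : UnitSphere) : Space3 :=
  (-2 * ‖x - (y : Space3)‖⁻¹ ^ 3) • (x - (y : Space3)) - (logArg x y)⁻¹ • logArgGrad x y

/-- The derivative of `greenGrad`. -/
def greenHess (x : Space3) (y : UnitSphere) : Space3 →L[ℝ] Space3 :=
  (-2 * ‖x - (y : Space3)‖⁻¹ ^ 3) • ContinuousLinearMap.id ℝ Space3 +
    ((6 * ‖x - (y : Space3)‖⁻¹ ^ 5) • innerL (x - y)).smulRight (x - (y : Space3)) -
  ((logArg x y)⁻¹ • logArgHess x y +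
    (-((logArg x y)⁻¹ ^ 2) • innerL (logArgGrad x y)).smulRight (logArgGrad x y))

section

variable {x : Space3} {y : UnitSphere}

lemma hasFDerivAt_logArg (h : x ≠ y) :
    HasFDerivAt (fun z => logArg z y) (innerL (logArgGrad x y)) x := by
  have h1 : HasFDerivAt (fun z : Space3 => (inner ℝ z (y : Space3) : ℝ)) (innerL y) x := by
    refine (innerL (y : Space3)).hasFDerivAt.congr_of_eventuallyEq
      (Eventually.of_forall fun z => ?_)
    rw [innerL_apply, real_inner_comm]
  refine ((h1.const_sub 1).add (hasFDerivAt_norm_sub h)).congr_fderiv ?_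
  simp only [logArgGrad, map_sub, map_smul]
  abel

lemma hasFDerivAt_logArgGrad (h : x ≠ y) :
    HasFDerivAt (fun z => logArgGrad z y) (logArgHess x y) x :=
  ((hasFDerivAt_inv_norm_sub h).smul ((hasFDerivAt_id x).sub_const (y : Space3))).sub_const _

lemma hasFDerivAt_inv_logArg (h : x ≠ y) (hq : logArg x y ≠ 0) :
    HasFDerivAt (fun z => (logArg z y)⁻¹) (-((logArg x y)⁻¹ ^ 2) • innerL (logArgGrad x y)) x := by
  refine ((hasDerivAt_inv hq).comp_hasFDerivAt x (hasFDerivAt_logArg h)).congr_fderiv ?_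
  ext k; simp

lemma hasFDerivAt_interiorGreen (h : x ≠ y) (hq : logArg x y ≠ 0) :
    HasFDerivAt (fun z => interiorGreen z y) (innerL (greenGrad x y)) x := by
  have h1 := (hasFDerivAt_inv_norm_sub h).const_mul 2
  have h2 := ((hasFDerivAt_inv_logArg h hq).const_mul 2).log (by simpa using hq)
  refine ((h1.add h2).congr_fderiv ?_)
  ext k
  simp [greenGrad]
  field_simp
  ring

lemma hasFDerivAt_greenGrad (h : x ≠ y) (hq : logArg x y ≠ 0) :
    HasFDerivAt (fun z => greenGrad z y) (greenHess x y) x := by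
  have h1 := (((hasFDerivAt_inv_norm_sub h).pow 3).const_mul (-2)).smul
    ((hasFDerivAt_id x).sub_const (y : Space3))
  have h2 := (hasFDerivAt_inv_logArg h hq).smul (hasFDerivAt_logArgGrad h)
  refine (h1.sub h2).congr_fderiv ?_
  unfold greenHess
  congr 1
  ext k
  simp
  left; ring

/-- With the unit vector u = (x - y)/s one has ∇q = u - y and q = s(1 - u·y), while |u - y|² = 2(1 -
u·y). -/
lemma norm_sq_logArgGrad (h : x ≠ y) :
    ‖logArgGrad x y‖ ^ 2 = 2 * logArg x y * ‖x - (y : Space3)‖⁻¹ := by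
  have hs := norm_sub_pos_of_ne h
  unfold logArgGrad logArg
  rw [norm_sub_sq_real, norm_smul, norm_inv, norm_norm, inv_mul_cancel₀ hs.ne', norm_unitSphere,
    inner_smul_left, inner_sub_left, real_inner_self_eq_norm_sq, norm_unitSphere]
  simp
  field_simp
  ring

/-- The trace of the Hessian is the Laplacian. The terms from 2/s cancel in dimension three; those
from -log q are -Δq/q + |∇q|²/q² = -2/(sq) + 2/(sq). -/
lemma sum_inner_greenHess (h : x ≠ y) (hq : logArg x y ≠ 0)
    (b : OrthonormalBasis (Fin 3) ℝ Space3) :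
    ∑ i, (inner ℝ (greenHess x y (b i)) (b i) : ℝ) = 0 := by
  have hs := norm_sub_pos_of_ne h
  have hb : ∀ i, (inner ℝ (b i) (b i) : ℝ) = 1 := fun i => by
    rw [real_inner_self_eq_norm_sq, b.norm_eq_one, one_pow]
  have hsum : ∀ u : Space3, ∑ i, (inner ℝ u (b i) : ℝ) * inner ℝ u (b i) = ‖u‖ ^ 2 := fun u => by
    rw [← real_inner_self_eq_norm_sq, ← b.sum_inner_mul_inner u u]
    simp_rw [real_inner_comm u]
  have e : ∀ i, (inner ℝ (greenHess x y (b i)) (b i) : ℝ) =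
      (-2 * ‖x - (y : Space3)‖⁻¹ ^ 3 - (logArg x y)⁻¹ * ‖x - (y : Space3)‖⁻¹) +
      (6 * ‖x - (y : Space3)‖⁻¹ ^ 5 + (logArg x y)⁻¹ * ‖x - (y : Space3)‖⁻¹ ^ 3) *
        (inner ℝ (x - (y : Space3)) (b i) * inner ℝ (x - (y : Space3)) (b i)) +
      (logArg x y)⁻¹ ^ 2 * (inner ℝ (logArgGrad x y) (b i) * inner ℝ (logArgGrad x y) (b i)) := by
    intro i
    simp only [greenHess, logArgHess, sub_apply, add_apply,
      smul_apply, ContinuousLinearMap.smulRight_apply, innerL_apply,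
      ContinuousLinearMap.id_apply, inner_sub_left (𝕜 := ℝ) (_ + _), inner_add_left,
      real_inner_smul_left, hb, smul_eq_mul]
    ring
  simp_rw [e]
  rw [Finset.sum_add_distrib, Finset.sum_add_distrib, ← Finset.mul_sum, ← Finset.mul_sum, hsum, hsum,
    norm_sq_logArgGrad h]
  simp
  field_simp
  ring

end

/-! ### Interior regularity of potentials -/

lemma ne_of_mem_ball {x : Space3} (hx : x ∈ ball (0 : Space3) 1) (y : UnitSphere) : x ≠ y := by
  rintro rfl
  simp at hx

lemma logArg_ne_zero {x : Space3} (hx : x ∈ ball (0 : Space3) 1) (y : UnitSphere) :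
    logArg x y ≠ 0 :=
  (logArg_pos (by simpa using (mem_ball.1 hx).le) (ne_of_mem_ball hx y)).ne'

lemma continuousOn_inv_norm_sub : ContinuousOn (fun p : Space3 × UnitSphere =>
    ‖p.1 - (p.2 : Space3)‖⁻¹) (ball 0 1 ×ˢ univ) :=
  ContinuousOn.inv₀ (by fun_prop) fun p hp => (norm_sub_pos_of_ne (ne_of_mem_ball hp.1 p.2)).ne'

lemma continuousOn_inv_logArg : ContinuousOn (fun p : Space3 × UnitSphere =>
    (logArg p.1 p.2)⁻¹) (ball 0 1 ×ˢ univ) :=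
  ContinuousOn.inv₀ (by unfold logArg; fun_prop) fun p hp => logArg_ne_zero hp.1 p.2

lemma continuousOn_interiorGreen : ContinuousOn (fun p : Space3 × UnitSphere =>
    interiorGreen p.1 p.2) (ball 0 1 ×ˢ univ) := by
  simp only [interiorGreen_eq, div_eq_mul_inv]
  refine (continuousOn_const.mul continuousOn_inv_norm_sub).add
    ((continuousOn_const.mul continuousOn_inv_logArg).log fun p hp => ?_)
  exact mul_ne_zero two_ne_zero (inv_ne_zero (logArg_ne_zero hp.1 p.2))

lemma continuousOn_logArgGrad : ContinuousOn (fun p : Space3 × UnitSphere =>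
    logArgGrad p.1 p.2) (ball 0 1 ×ˢ univ) := by
  unfold logArgGrad
  exact (continuousOn_inv_norm_sub.smul (by fun_prop)).sub (by fun_prop)

lemma continuousOn_greenGrad : ContinuousOn (fun p : Space3 × UnitSphere =>
    greenGrad p.1 p.2) (ball 0 1 ×ˢ univ) := by
  unfold greenGrad
  exact ((continuousOn_const.mul (continuousOn_inv_norm_sub.pow 3)).smul (by fun_prop)).sub
    (continuousOn_inv_logArg.smul continuousOn_logArgGrad)

lemma continuousOn_smulRight_innerL {X : Type*} [TopologicalSpace X] {s : Set X} {c : X → ℝ}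
    {u : X → Space3} (hc : ContinuousOn c s) (hu : ContinuousOn u s) :
    ContinuousOn (fun p => (c p • innerL (u p)).smulRight (u p)) s := by
  have h1 : ContinuousOn (fun p => c p • innerL (u p)) s :=
    hc.smul (innerL.continuous.comp_continuousOn hu)
  have h2 := ((ContinuousLinearMap.smulRightL ℝ Space3 Space3).continuous.comp_continuousOn h1)
  exact h2.clm_apply hu

lemma continuousOn_greenHess : ContinuousOn (fun p : Space3 × UnitSphere =>
    greenHess p.1 p.2) (ball 0 1 ×ˢ univ) := by
  have hs := continuousOn_inv_norm_sub
  have hq := continuousOn_inv_logArg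
  have hu : ContinuousOn (fun p : Space3 × UnitSphere => p.1 - (p.2 : Space3)) (ball 0 1 ×ˢ univ) := by
    fun_prop
  unfold greenHess logArgHess
  refine (((continuousOn_const.mul (hs.pow 3)).smul continuousOn_const).add
    (continuousOn_smulRight_innerL (continuousOn_const.mul (hs.pow 5)) hu)).sub
    ((hq.smul ((hs.smul continuousOn_const).add
      (continuousOn_smulRight_innerL (hs.pow 3).neg hu))).add
      (continuousOn_smulRight_innerL (hq.pow 2).neg continuousOn_logArgGrad))

/-- The gradient of a potential. -/
def potentialGrad (f : UnitSphere → ℝ) (x : Space3) : Space3 →L[ℝ] ℝ :=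
  ∫ y, f y • innerL (greenGrad x y) ∂surfaceMeasure

/-- The Hessian of a potential. -/
def potentialHess (f : UnitSphere → ℝ) (x : Space3) : Space3 →L[ℝ] Space3 →L[ℝ] ℝ :=
  ∫ y, f y • innerL.comp (greenHess x y) ∂surfaceMeasure

lemma continuousOn_innerL_greenHess : ContinuousOn (fun p : Space3 × UnitSphere =>
    innerL.comp (greenHess p.1 p.2)) (ball 0 1 ×ˢ univ) :=
  continuousOn_const.clm_comp continuousOn_greenHess

lemma hasFDerivAt_potential {f : UnitSphere → ℝ} (hf : Integrable f surfaceMeasure) {x : Space3}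
    (hx : x ∈ ball (0 : Space3) 1) : HasFDerivAt (potential f) (potentialGrad f x) x := by
  have h := hasFDerivAt_integral_smul (H := interiorGreen)
    (H' := fun x y => innerL (greenGrad x y)) isOpen_ball hf
    continuousOn_interiorGreen (innerL.continuous.comp_continuousOn continuousOn_greenGrad)
    (fun z hz y => hasFDerivAt_interiorGreen (ne_of_mem_ball hz y) (logArg_ne_zero hz y)) hx
  have e : potential f = fun x => ∫ y, f y • interiorGreen x y ∂surfaceMeasure := by
    ext z
    simp only [potential, smul_eq_mul, mul_comm]
  rw [e]
  exact h

lemma hasFDerivAt_potentialGrad {f : UnitSphere → ℝ} (hf : Integrable f surfaceMeasure) {x : Space3}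
    (hx : x ∈ ball (0 : Space3) 1) : HasFDerivAt (potentialGrad f) (potentialHess f x) x :=
  hasFDerivAt_integral_smul (H := fun x y => innerL (greenGrad x y))
    (H' := fun x y => innerL.comp (greenHess x y)) isOpen_ball hf
    (innerL.continuous.comp_continuousOn continuousOn_greenGrad) continuousOn_innerL_greenHess
    (fun z hz y => innerL.hasFDerivAt.comp z
      (hasFDerivAt_greenGrad (ne_of_mem_ball hz y) (logArg_ne_zero hz y))) hx

lemma continuousOn_potentialHess {f : UnitSphere → ℝ} (hf : Integrable f surfaceMeasure) :
    ContinuousOn (potentialHess f) (ball 0 1) :=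
  continuousOn_integral_smul isOpen_ball hf continuousOn_innerL_greenHess

lemma sum_potentialHess {f : UnitSphere → ℝ} (hf : Integrable f surfaceMeasure) {x : Space3}
    (hx : x ∈ ball (0 : Space3) 1) (b : OrthonormalBasis (Fin 3) ℝ Space3) :
    ∑ i, potentialHess f x (b i) (b i) = 0 := by
  have hi := integrable_smul_slice (H := fun x y => innerL.comp (greenHess x y))
    isOpen_ball hf continuousOn_innerL_greenHess hx
  have e : ∀ i, potentialHess f x (b i) (b i) =
      ∫ y, f y * (inner ℝ (greenHess x y (b i)) (b i) : ℝ) ∂surfaceMeasure := by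
    intro i
    unfold potentialHess
    rw [ContinuousLinearMap.integral_apply hi,
      ContinuousLinearMap.integral_apply (hi.apply_continuousLinearMap _)]
    rfl
  have hi' : ∀ i, Integrable (fun y => f y * (inner ℝ (greenHess x y (b i)) (b i) : ℝ))
      surfaceMeasure := fun i =>
    (hi.apply_continuousLinearMap (b i)).apply_continuousLinearMap (b i)
  simp_rw [e]
  rw [← integral_finsetSum _ fun i _ => hi' i]
  simp_rw [← Finset.mul_sum,
    fun y => sum_inner_greenHess (ne_of_mem_ball hx y) (logArg_ne_zero hx y) b]
  simp

lemma harmonicOnNhd_potential {f : UnitSphere → ℝ} (hf : Integrable f surfaceMeasure) :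
    InnerProductSpace.HarmonicOnNhd (potential f) (ball 0 1) := by
  have hfd : ∀ x ∈ ball (0 : Space3) 1, fderiv ℝ (potential f) x = potentialGrad f x :=
    fun x hx => (hasFDerivAt_potential hf hx).fderiv
  have hfd2 : ∀ x ∈ ball (0 : Space3) 1, fderiv ℝ (potentialGrad f) x = potentialHess f x :=
    fun x hx => (hasFDerivAt_potentialGrad hf hx).fderiv
  have hC1 : ContDiffOn ℝ (0 + 1) (potentialGrad f) (ball 0 1) :=
    (contDiffOn_succ_iff_fderiv_of_isOpen isOpen_ball).2
      ⟨fun x hx => (hasFDerivAt_potentialGrad hf hx).differentiableAt.differentiableWithinAt,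
        by simp, contDiffOn_zero.2 <| (continuousOn_potentialHess hf).congr hfd2⟩
  have hC2 : ContDiffOn ℝ (1 + 1) (potential f) (ball 0 1) :=
    (contDiffOn_succ_iff_fderiv_of_isOpen isOpen_ball).2
      ⟨fun x hx => (hasFDerivAt_potential hf hx).differentiableAt.differentiableWithinAt,
        by simp, (zero_add (1 : WithTop ℕ∞) ▸ hC1).congr hfd⟩
  intro x hx
  refine ⟨?_, ?_⟩
  · have := hC2.contDiffAt (isOpen_ball.mem_nhds hx)
    rwa [one_add_one_eq_two] at this
  · filter_upwards [isOpen_ball.mem_nhds hx] with z hz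
    rw [InnerProductSpace.laplacian_eq_iteratedFDeriv_orthonormalBasis _
      (EuclideanSpace.basisFun (Fin 3) ℝ)]
    simp only [iteratedFDeriv_two_apply, Matrix.cons_val_zero, Matrix.cons_val_one]
    have : fderiv ℝ (fderiv ℝ (potential f)) z = potentialHess f z := by
      rw [← hfd2 z hz]
      exact (Filter.eventuallyEq_of_mem (isOpen_ball.mem_nhds hz) hfd).fderiv_eq
    rw [this]
    exact sum_potentialHess hf hz _

/-! ### The Green's function along radii -/

lemma norm_smul_sub_sq (x y : UnitSphere) (ρ : ℝ) :
    ‖ρ • (x : Space3) - (y : Space3)‖ ^ 2 =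
      1 - 2 * ρ * inner ℝ (x : Space3) (y : Space3) + ρ ^ 2 := by
  rw [norm_sub_sq_real, norm_smul, real_inner_smul_left, norm_unitSphere, norm_unitSphere,
    Real.norm_eq_abs, mul_pow, sq_abs]
  ring

/-- The radial derivative of the Green's function is `(P - 1) / ρ` with `P` the Poisson kernel. -/
lemma hasDerivAt_interiorGreen_radial {x y : UnitSphere} {ρ : ℝ} (hρ : ρ ≠ 0)
    (h : ρ • (x : Space3) ≠ y) (hq : logArg (ρ • (x : Space3)) y ≠ 0) :
    HasDerivAt (fun t : ℝ => interiorGreen (t • (x : Space3)) y)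
      (((1 - ρ ^ 2) / ‖ρ • (x : Space3) - (y : Space3)‖ ^ 3 - 1) / ρ) ρ := by
  have hs := norm_sub_pos_of_ne h
  have h1 : HasDerivAt (fun t : ℝ => t • (x : Space3)) (x : Space3) ρ := by
    simpa using (hasDerivAt_id ρ).smul_const (x : Space3)
  refine ((hasFDerivAt_interiorGreen h hq).comp_hasDerivAt ρ h1).congr_deriv ?_
  have hsq := norm_smul_sub_sq x y ρ
  unfold greenGrad logArgGrad
  unfold logArg at hq ⊢
  rw [real_inner_smul_left] at hq ⊢
  simp only [innerL_apply, inner_sub_left, real_inner_smul_left, real_inner_self_eq_norm_sq,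
    norm_unitSphere, real_inner_comm (x : Space3) (y : Space3)]
  set s := ‖ρ • (x : Space3) - (y : Space3)‖
  set c : ℝ := inner ℝ (x : Space3) (y : Space3)
  rw [eq_div_iff hρ]
  have hs0 := hs.ne'
  -- This factorization is equivalent to s² = 1 - 2ρc + ρ². It cancels q, so the logarithm
  -- contributes 1/s - 1 to ρ times the radial derivative.
  have key : ρ * (ρ - c) - ρ * c * s = (s - 1) * (1 - ρ * c + s) := by linear_combination -hsq
  have k1 : (1 - ρ * c + s)⁻¹ * (s⁻¹ * (ρ * 1 ^ 2 - c) - c) * ρ = (s - 1) / s := by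
    rw [inv_mul_eq_div, div_mul_eq_mul_div, div_eq_div_iff hq hs0]
    field_simp
    linear_combination key
  rw [sub_mul, k1]
  field_simp
  linear_combination hsq

/-- G(ρx, y) + log ρ has radial derivative P/ρ ≥ 0 for 0 < ρ ≤ 1. The bound needs no distance
between x and y beyond x ≠ y, so it can be integrated against a density charging every neighbourhood
of x. -/
lemma interiorGreen_smul_le {x y : UnitSphere} (h : (x : Space3) ≠ y) {r : ℝ} (hr : 0 < r) (hr1 : r ≤ 1) :
    interiorGreen (r • (x : Space3)) y ≤ interiorGreen x y - Real.log r := by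
  have hne : ∀ ρ ∈ Icc r 1, ρ • (x : Space3) ≠ y := by
    intro ρ hρ he
    have h1 : ρ = 1 := by
      have := congrArg norm he
      rw [norm_smul, norm_unitSphere, norm_unitSphere, mul_one, Real.norm_of_nonneg (hr.le.trans hρ.1)] at this
      exact this
    rw [h1, one_smul] at he
    exact h he
  have hd : ∀ ρ ∈ Icc r 1, HasDerivAt (fun t : ℝ => interiorGreen (t • (x : Space3)) y + Real.log t)
      (((1 - ρ ^ 2) / ‖ρ • (x : Space3) - (y : Space3)‖ ^ 3 - 1) / ρ + ρ⁻¹) ρ := by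
    intro ρ hρ
    have hρ0 : 0 < ρ := hr.trans_le hρ.1
    refine (hasDerivAt_interiorGreen_radial hρ0.ne' (hne ρ hρ) (logArg_pos ?_ (hne ρ hρ)).ne').add
      (Real.hasDerivAt_log hρ0.ne')
    rw [norm_smul, norm_unitSphere, mul_one, Real.norm_of_nonneg hρ0.le]; exact hρ.2
  have hmono : MonotoneOn (fun t : ℝ => interiorGreen (t • (x : Space3)) y + Real.log t) (Icc r 1) := by
    refine monotoneOn_of_deriv_nonneg (convex_Icc r 1)
      (fun ρ hρ => (hd ρ hρ).continuousAt.continuousWithinAt)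
      (fun ρ hρ => (hd ρ (interior_subset hρ)).differentiableAt.differentiableWithinAt) fun ρ hρ => ?_
    have hρ' := interior_subset hρ
    have hρ0 : 0 < ρ := hr.trans_le hρ'.1
    rw [(hd ρ hρ').deriv]
    have e : ((1 - ρ ^ 2) / ‖ρ • (x : Space3) - (y : Space3)‖ ^ 3 - 1) / ρ + ρ⁻¹ =
      (1 - ρ ^ 2) / ‖ρ • (x : Space3) - (y : Space3)‖ ^ 3 / ρ := by ring
    rw [e]
    have : 0 ≤ 1 - ρ ^ 2 := by nlinarith [hρ'.2]
    positivity
  have := hmono (left_mem_Icc.2 hr1) (right_mem_Icc.2 hr1) hr1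
  simp only [one_smul, Real.log_one, add_zero] at this
  linarith

/-- The outward normal derivative of a potential at a point away from its density. -/
lemma hasDerivAt_potential_radial {f : UnitSphere → ℝ} (hf : Integrable f surfaceMeasure)
    {x : UnitSphere} {r : ℝ} (hr : 0 < r) (hf0 : ∀ y : UnitSphere, ‖(x : Space3) - y‖ < r → f y = 0) :
    HasDerivAt (fun t : ℝ => potential f ((x : Space3) + t • (x : Space3)))
      (-∫ y, f y ∂surfaceMeasure) 0 := by
  -- The bound r/4 keeps (1 + t)x at distance at least r/2 from the support and keeps q positive
  -- even slightly outside the ball; the bound 1/2 keeps 1 + t away from 0. The derivative is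
  -- therefore two-sided.
  set δ : ℝ := min (1 / 2) (r / 4)
  have hδ : 0 < δ := by positivity
  have hδ1 : δ ≤ 1 / 2 := min_le_left _ _
  have hδ2 : δ ≤ r / 4 := min_le_right _ _
  have far : ∀ y : UnitSphere, r ≤ ‖(x : Space3) - y‖ → ∀ t ∈ ball (0 : ℝ) δ,
      r / 2 ≤ ‖(1 + t) • (x : Space3) - y‖ ∧ 0 < logArg ((1 + t) • (x : Space3)) y ∧ 1 / 2 ≤ 1 + t ∧
      |t| ≤ 1 / 2 := by
    intro y hy t ht
    have ht : |t| < δ := by simpa using ht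
    have h1 : r / 2 ≤ ‖(1 + t) • (x : Space3) - y‖ := by
      have e : (x : Space3) - y = ((1 + t) • (x : Space3) - y) - t • (x : Space3) := by module
      have := norm_sub_le ((1 + t) • (x : Space3) - y) (t • (x : Space3))
      rw [← e, norm_smul, norm_unitSphere, mul_one, Real.norm_eq_abs] at this
      linarith
    have ht2 := abs_le.1 (ht.le.trans hδ1)
    refine ⟨h1, ?_, by linarith, ht.le.trans hδ1⟩
    have h2 := inner_le_norm_unitSphere ((1 + t) • (x : Space3)) y
    rw [norm_smul, norm_unitSphere, mul_one, Real.norm_of_nonneg (by linarith)] at h2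
    have := le_abs_self t
    unfold logArg
    linarith
  have hne : ∀ y : UnitSphere, r ≤ ‖(x : Space3) - y‖ → ∀ t ∈ ball (0 : ℝ) δ,
      (1 + t) • (x : Space3) ≠ y := by
    intro y hy t ht he
    have := (far y hy t ht).1
    rw [he, sub_self, norm_zero] at this
    linarith
  have hmeas : ∀ t : ℝ, AEStronglyMeasurable
      (fun y => interiorGreen ((1 + t) • (x : Space3)) y * f y) surfaceMeasure := fun t =>
    (measurable_interiorGreen _).aestronglyMeasurable.mul hf.1
  have key := (hasDerivAt_integral_of_dominated_loc_of_deriv_le (μ := surfaceMeasure) (x₀ := (0 : ℝ))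
    (F := fun t y => interiorGreen ((1 + t) • (x : Space3)) y * f y)
    (F' := fun t y => ((1 - (1 + t) ^ 2) / ‖(1 + t) • (x : Space3) - (y : Space3)‖ ^ 3 - 1) /
      (1 + t) * f y)
    (bound := fun y => (2 / (r / 2) ^ 3 + 1) / (1 / 2) * |f y|)
    (ball_mem_nhds 0 hδ) (Eventually.of_forall hmeas) ?_ ?_ ?_ (hf.abs.const_mul _) ?_).2
  · have e : (fun t : ℝ => potential f ((x : Space3) + t • (x : Space3))) =
        fun t => ∫ y, interiorGreen ((1 + t) • (x : Space3)) y * f y ∂surfaceMeasure := by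
      ext t
      simp only [potential, add_smul, one_smul]
    rw [e]
    refine key.congr_deriv ?_
    simp [← integral_neg]
  · simpa using integrable_green_mul_of_vanishing hf hr hf0 (norm_unitSphere x).le (by simp; positivity)
  · exact hf.1.neg.congr (ae_of_all _ fun y => by simp)
  · refine ae_of_all _ fun y t ht => ?_
    rcases lt_or_ge ‖(x : Space3) - y‖ r with h | h
    · simp [hf0 y h]
    · obtain ⟨h1, -, h3, h4⟩ := far y h t ht
      rw [norm_mul, Real.norm_eq_abs (f y), norm_div, Real.norm_of_nonneg (by linarith : 0 ≤ 1 + t)]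
      have h5 : |1 - (1 + t) ^ 2| ≤ 2 := by
        have := abs_le.1 h4
        rw [abs_le]; constructor <;> nlinarith
      gcongr
      refine (norm_sub_le _ _).trans ?_
      rw [norm_div, norm_pow, norm_norm, norm_one, Real.norm_eq_abs]
      gcongr
  · refine ae_of_all _ fun y t ht => ?_
    rcases lt_or_ge ‖(x : Space3) - y‖ r with h | h
    · simpa [hf0 y h] using hasDerivAt_const t (0 : ℝ)
    · obtain ⟨h1, h2, h3, h4⟩ := far y h t ht
      have := (hasDerivAt_interiorGreen_radial (by linarith) (hne y h t ht) h2.ne').comp_const_add 1 t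
      exact this.mul_const _

/-! ### A minimum principle -/

/-- Were H e e negative, the second derivative test along the line in direction e would make the
point a local maximum as well. The restriction would be locally constant, with second derivative 0.
-/
lemma IsLocalMin.hessian_nonneg {E : Type*} [NormedAddCommGroup E] [NormedSpace ℝ E] {v : E → ℝ}
    {x : E} (hmin : IsLocalMin v x) {V : E → E →L[ℝ] ℝ} {H : E →L[ℝ] E →L[ℝ] ℝ}
    (hv : ∀ᶠ z in 𝓝 x, HasFDerivAt v (V z) z) (hV : HasFDerivAt V H x) (e : E) : 0 ≤ H e e := by
  by_contra! hneg
  have hline : ∀ t : ℝ, HasDerivAt (fun t : ℝ => x + t • e) e t := fun t => by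
    simpa using ((hasDerivAt_id t).smul_const e).const_add x
  have hc0 : Tendsto (fun t : ℝ => x + t • e) (𝓝 0) (𝓝 x) := by
    simpa using (hline 0).continuousAt.tendsto
  set φ : ℝ → ℝ := fun t => v (x + t • e)
  have h1 : deriv φ =ᶠ[𝓝 0] fun t => V (x + t • e) e := by
    filter_upwards [hc0.eventually hv] with t ht
    exact (ht.comp_hasDerivAt t (hline t)).deriv
  have h2 : deriv (deriv φ) 0 = H e e := by
    rw [h1.deriv_eq]
    have hV' : HasFDerivAt V H (x + (0 : ℝ) • e) := by simpa using hV
    have hd : HasDerivAt (fun t : ℝ => V (x + t • e)) (H e) 0 := hV'.comp_hasDerivAt 0 (hline 0)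
    exact ((ContinuousLinearMap.apply ℝ ℝ e).hasFDerivAt.comp_hasDerivAt 0 hd).deriv
  have hφmin : IsLocalMin φ 0 := by
    have := hc0.eventually hmin
    filter_upwards [this] with t ht
    simpa [φ] using ht
  have hφc : ContinuousAt φ 0 := by
    have hv0 : HasFDerivAt v (V x) (x + (0 : ℝ) • e) := by simpa using hv.self_of_nhds
    exact (hv0.comp_hasDerivAt 0 (hline 0)).continuousAt
  have hφmax : IsLocalMax φ 0 :=
    isLocalMax_of_deriv_deriv_neg (h2 ▸ hneg) hφmin.deriv_eq_zero hφc
  have hconst : φ =ᶠ[𝓝 0] fun _ => φ 0 := by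
    filter_upwards [hφmin, hφmax] with t h1 h2 using le_antisymm h2 h1
  have h3 : deriv φ =ᶠ[𝓝 0] fun _ => 0 := by
    filter_upwards [hconst.eventuallyEq_nhds] with t ht
    rw [ht.deriv_eq, deriv_const]
  rw [h3.deriv_eq, deriv_const] at h2
  linarith

/-- The potentials are harmonic, so the Hessian has trace -6δ < 0, whereas at a local minimum its
diagonal entries are nonnegative. -/
lemma not_isLocalMin_potential_sub {a b : UnitSphere → ℝ} (ha : Integrable a surfaceMeasure)
    (hb : Integrable b surfaceMeasure) {δ : ℝ} (hδ : 0 < δ) {x : Space3}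
    (hx : x ∈ ball (0 : Space3) 1) :
    ¬ IsLocalMin (fun z => potential a z - potential b z - δ * ‖z‖ ^ 2) x := by
  intro hmin
  have hv : ∀ᶠ z in 𝓝 x, HasFDerivAt (fun z => potential a z - potential b z - δ * ‖z‖ ^ 2)
      (potentialGrad a z - potentialGrad b z - (2 * δ) • innerL z) z := by
    filter_upwards [isOpen_ball.mem_nhds hx] with z hz
    refine ((hasFDerivAt_potential ha hz).sub (hasFDerivAt_potential hb hz)).sub ?_
    refine ((hasFDerivAt_id z).norm_sq.const_mul δ).congr_fderiv ?_
    ext k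
    simp
    ring
  have hV : HasFDerivAt (fun z => potentialGrad a z - potentialGrad b z - (2 * δ) • innerL z)
      (potentialHess a x - potentialHess b x - (2 * δ) • innerL) x :=
    ((hasFDerivAt_potentialGrad ha hx).sub (hasFDerivAt_potentialGrad hb hx)).sub
      (innerL.hasFDerivAt.const_smul (2 * δ))
  set B := EuclideanSpace.basisFun (Fin 3) ℝ
  have h0 : 0 ≤ ∑ i, (potentialHess a x - potentialHess b x - (2 * δ) • innerL) (B i) (B i) :=
    Finset.sum_nonneg fun i _ => hmin.hessian_nonneg hv hV (B i)
  have hB : ∀ i, (inner ℝ (B i) (B i) : ℝ) = 1 := fun i => by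
    rw [real_inner_self_eq_norm_sq, B.norm_eq_one, one_pow]
  simp only [sub_apply, smul_apply, innerL_apply, hB, Finset.sum_sub_distrib,
    sum_potentialHess ha hx, sum_potentialHess hb hx] at h0
  simp at h0
  linarith

lemma potential_smul_le {a : UnitSphere → ℝ} (ha : Integrable a surfaceMeasure) (ha0 : ∀ y, 0 ≤ a y)
    {A : ℝ} (hA : ∀ y, |a y| ≤ A) (x : UnitSphere) {r : ℝ} (hr : 0 < r) (hr1 : r ≤ 1) :
    potential a (r • (x : Space3)) ≤ potential a x - Real.log r * ∫ y, a y ∂surfaceMeasure := by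
  have hx := (norm_unitSphere x).le
  have hrx : ‖r • (x : Space3)‖ ≤ 1 := by
    rw [norm_smul, norm_unitSphere, mul_one, Real.norm_of_nonneg hr.le]; exact hr1
  unfold potential
  rw [← integral_const_mul, ← integral_sub (integrable_green_mul_of_bounded ha hA hx) (ha.const_mul _)]
  refine integral_mono_ae (integrable_green_mul_of_bounded ha hA hrx)
    ((integrable_green_mul_of_bounded ha hA hx).sub (ha.const_mul _)) ?_
  -- The pole y = x is discarded: G(x, x) = 0 by convention, and the pointwise bound can fail there.
  filter_upwards [ae_ne_unitSphere hx] with y hy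
  rw [← sub_mul]
  exact mul_le_mul_of_nonneg_right (interiorGreen_smul_le hy hr hr1) (ha0 y)

/-- A Hopf-type argument. The potential of a may have no radial derivative at x, so its increment is
replaced by the upper bound -log(1 + t) ∫ a, which is differentiable at t = 0. -/
lemma not_isMinOn_potential_sub {a b : UnitSphere → ℝ} (ha : Integrable a surfaceMeasure)
    (ha0 : ∀ y, 0 ≤ a y) {A : ℝ} (hA : ∀ y, |a y| ≤ A) (hb : Integrable b surfaceMeasure)
    {x : UnitSphere} {r : ℝ} (hr : 0 < r) (hb0 : ∀ y : UnitSphere, ‖(x : Space3) - y‖ < r → b y = 0)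
    {δ : ℝ} (hδ : 2 * δ < ∫ y, b y ∂surfaceMeasure - ∫ y, a y ∂surfaceMeasure) :
    ¬ IsMinOn (fun z => potential a z - potential b z - δ * ‖z‖ ^ 2) (closedBall 0 1) (x : Space3) := by
  intro hmin
  -- φ(t) bounds from above the increment of the function from x to (1 + t)x. A minimum at x forces
  -- φ ≥ 0 for t < 0, hence φ'(0) ≤ 0, against the choice of δ.
  set φ : ℝ → ℝ := fun t => -(Real.log (1 + t) * ∫ y, a y ∂surfaceMeasure) -
    (potential b ((x : Space3) + t • (x : Space3)) - potential b x) - δ * ((1 + t) ^ 2 - 1)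
  have hφ : HasDerivAt φ (-(∫ y, a y ∂surfaceMeasure) + ∫ y, b y ∂surfaceMeasure - 2 * δ) 0 := by
    have h1 : HasDerivAt (fun t : ℝ => 1 + t) 1 0 := (hasDerivAt_id 0).const_add 1
    have h2 := (h1.log (by simp)).mul_const (∫ y, a y ∂surfaceMeasure)
    have h3 := (hasDerivAt_potential_radial hb hr hb0).sub_const (potential b x)
    have h4 := ((h1.pow 2).sub_const 1).const_mul δ
    refine ((h2.neg.sub h3).sub h4).congr_deriv ?_
    simp
    ring
  have hφ0 : φ 0 = 0 := by simp [φ]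
  have hnonneg : ∀ t ∈ Ioo (-1 : ℝ) 0, 0 ≤ φ t := by
    intro t ht
    have h0 : 0 < 1 + t := by linarith [ht.1]
    have h1 : 1 + t ≤ 1 := by linarith [ht.2]
    have hn : ‖(1 + t) • (x : Space3)‖ = 1 + t := by
      rw [norm_smul, norm_unitSphere, mul_one, Real.norm_of_nonneg h0.le]
    have h2 := hmin (show (1 + t) • (x : Space3) ∈ closedBall (0 : Space3) 1 by
      rw [mem_closedBall_zero_iff, hn]; exact h1)
    simp only [mem_ofPred_eq, hn, norm_unitSphere] at h2
    have h3 := potential_smul_le ha ha0 hA x h0 h1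
    have e : (x : Space3) + t • (x : Space3) = (1 + t) • (x : Space3) := by module
    simp only [φ, e]
    linarith
  have hslope := hφ.tendsto_slope.mono_left (nhdsLT_le_nhdsNE (0 : ℝ))
  have hle : -(∫ y, a y ∂surfaceMeasure) + ∫ y, b y ∂surfaceMeasure - 2 * δ ≤ 0 := by
    refine le_of_tendsto hslope ?_
    filter_upwards [Ioo_mem_nhdsLT (show (-1 : ℝ) < 0 by norm_num)] with t ht
    rw [slope_def_field, hφ0, sub_zero, sub_zero]
    exact div_nonpos_of_nonneg_of_nonpos (hnonneg t ht) ht.2.le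
  linarith

/-- A difference of potentials of nonnegative densities with negative total mass cannot be bounded
below by a positive constant on the support of the negative part. -/
lemma exists_potential_sub_lt {a b : UnitSphere → ℝ} (ha : Integrable a surfaceMeasure)
    (ha0 : ∀ y, 0 ≤ a y) {A : ℝ} (hA : ∀ y, |a y| ≤ A) (hb : Integrable b surfaceMeasure)
    {B : ℝ} (hB : ∀ y, |b y| ≤ B) {K : Set UnitSphere} (hK : IsClosed K) (hbK : ∀ y ∉ K, b y = 0)
    (hab : ∫ y, a y ∂surfaceMeasure < ∫ y, b y ∂surfaceMeasure) {c : ℝ} (hc : 0 < c) :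
    ∃ x ∈ K, potential a x - potential b x < c := by
  by_contra! hcK
  set m := ∫ y, b y ∂surfaceMeasure - ∫ y, a y ∂surfaceMeasure with hm
  have hm0 : 0 < m := sub_pos.2 hab
  set δ := min (c / 2) (m / 4)
  have hδ : 0 < δ := by positivity
  have hδ1 : δ ≤ c / 2 := min_le_left _ _
  have hδ2 : δ ≤ m / 4 := min_le_right _ _
  obtain ⟨x, hx, hmin⟩ := (isCompact_closedBall (0 : Space3) 1).exists_isMinOn
    ⟨0, by simp⟩ (f := fun z => potential a z - potential b z - δ * ‖z‖ ^ 2)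
    (((continuousOn_potential_of_bounded ha hA).sub (continuousOn_potential_of_bounded hb hB)).sub
      (by fun_prop))
  rcases (mem_closedBall_zero_iff.1 hx).lt_or_eq with h | h
  · have hx' : x ∈ ball (0 : Space3) 1 := mem_ball_zero_iff.2 h
    exact not_isLocalMin_potential_sub ha hb hδ hx'
      (hmin.isLocalMin (mem_of_superset (isOpen_ball.mem_nhds hx') ball_subset_closedBall))
  · lift x to UnitSphere using by simpa using h
    by_cases hxK : x ∈ K
    -- On K the function is at least c - δ > 0, but at the origin, where G = 2, it equals -2m < 0.
    · have h1 := hmin (show (0 : Space3) ∈ closedBall 0 1 by simp)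
      have h2 := hcK x hxK
      simp only [mem_ofPred_eq, potential_zero, h, norm_zero] at h1
      linarith
    · obtain ⟨r, hr, hrK⟩ := Metric.isOpen_iff.1 hK.isOpen_compl x hxK
      refine not_isMinOn_potential_sub ha ha0 hA hb hr (fun y hy => hbK y (hrK ?_)) (by linarith) hmin
      rw [mem_ball, dist_comm, Subtype.dist_eq, dist_eq_norm]
      exact hy

/-! ### The mixed problem and the nonvanishing of the total density -/

section

variable {ΓA : Set UnitSphere} {σ : UnitSphere → ℝ}

lemma isLocallyBounded_indicator (hopen : IsOpen ΓA) (hcont : ContinuousOn σ ΓA) {x : UnitSphere}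
    (hx : x ∈ ΓA) : ∃ r > 0, ∃ M : ℝ, ∀ y : UnitSphere, ‖(x : Space3) - y‖ < r →
      |ΓA.indicator σ y| ≤ M := by
  have hc : ContinuousAt σ x := hcont.continuousAt (hopen.mem_nhds hx)
  have h : ∀ᶠ y in 𝓝 x, |ΓA.indicator σ y| ≤ |σ x| + 1 := by
    filter_upwards [hopen.mem_nhds hx, hc.abs.eventually_lt_const (lt_add_one |σ x|)] with y hy hy'
    rw [indicator_of_mem hy]
    exact hy'.le
  obtain ⟨r, hr, hrM⟩ := Metric.eventually_nhds_iff.1 h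
  refine ⟨r, hr, |σ x| + 1, fun y hy => hrM ?_⟩
  rwa [dist_comm, Subtype.dist_eq, dist_eq_norm]

lemma indicator_eq_zero_near {x : UnitSphere} (hx : x ∈ interior (reflecting ΓA)) :
    ∃ r > 0, ∀ y : UnitSphere, ‖(x : Space3) - y‖ < r → ΓA.indicator σ y = 0 := by
  obtain ⟨r, hr, h⟩ := Metric.isOpen_iff.1 isOpen_interior x hx
  refine ⟨r, hr, fun y hy => indicator_of_notMem (interior_subset (h ?_)) _⟩
  rwa [mem_ball, dist_comm, Subtype.dist_eq, dist_eq_norm]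

lemma solvesMixedProblem_singleLayer (hopen : IsOpen ΓA)
    (hcont : ContinuousOn σ ΓA) (hint : IntegrableOn σ ΓA surfaceMeasure)
    (heq : ∀ x ∈ ΓA, singleLayer ΓA σ x = 1) :
    SolvesMixedProblem ΓA (-totalDensity ΓA σ) (singleLayer ΓA σ) := by
  have hf : Integrable (ΓA.indicator σ) surfaceMeasure := (integrable_indicator_iff hopen.measurableSet).2 hint
  have e : singleLayer ΓA σ = potential (ΓA.indicator σ) :=
    funext (singleLayer_eq_potential hopen.measurableSet σ)
  have e' : totalDensity ΓA σ = ∫ y, ΓA.indicator σ y ∂surfaceMeasure :=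
    (integral_indicator hopen.measurableSet).symm
  refine ⟨?_, ?_, heq, ?_⟩
  · rw [e]; exact harmonicOnNhd_potential hf
  · rw [e]
    have hsub : ball 0 1 ∪ (fun x : UnitSphere => (x : Space3)) '' (ΓA ∪ interior (reflecting ΓA)) ⊆
        closedBall 0 1 := by
      rintro _ (hx | ⟨x, -, rfl⟩)
      · exact ball_subset_closedBall hx
      · simp
    rintro _ (hx | ⟨x, hx | hx, rfl⟩)
    · exact (hasFDerivAt_potential hf hx).continuousAt.continuousWithinAt
    · obtain ⟨r, hr, M, hM⟩ := isLocallyBounded_indicator hopen hcont hx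
      exact (continuousWithinAt_potential_of_locallyBounded hf hr hM (norm_unitSphere x).le).mono hsub
    · obtain ⟨r, hr, h0⟩ := indicator_eq_zero_near (σ := σ) hx
      exact (continuousWithinAt_potential_of_vanishing hf (norm_unitSphere x).le hr h0).mono hsub
  · intro x hx
    obtain ⟨r, hr, h0⟩ := indicator_eq_zero_near (σ := σ) hx
    rw [e, e']
    exact (hasDerivAt_potential_radial hf hr h0).hasDerivWithinAt

/-- The potentials of truncations of a locally bounded density converge uniformly on compact sets. -/
lemma exists_potential_truncation {f : UnitSphere → ℝ} (hf : Integrable f surfaceMeasure)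
    (hf0 : ∀ y, 0 ≤ f y) {K : Set UnitSphere} (hK : IsCompact K)
    (hloc : ∀ x ∈ K, ∃ r > 0, ∃ M : ℝ, ∀ y : UnitSphere, ‖(x : Space3) - y‖ < r → |f y| ≤ M)
    {η : ℝ} (hη : 0 < η) :
    ∃ n : ℕ, ∀ x ∈ K, potential f x - η < potential (fun y => min (f y) n) x := by
  have hint : ∀ n : ℕ, Integrable (fun y => min (f y) n) surfaceMeasure := fun n =>
    hf.inf (integrable_const _)
  have hnn : ∀ (n : ℕ) y, 0 ≤ min (f y) n := fun n y => le_min (hf0 y) (Nat.cast_nonneg n)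
  have hbd : ∀ (n : ℕ) y, |min (f y) n| ≤ n := fun n y => by
    rw [abs_of_nonneg (hnn n y)]; exact min_le_right _ _
  -- Dini's theorem on K: the truncated potentials increase with n, and the limit is continuous on K
  -- because f is locally bounded there.
  have hunif := Monotone.tendstoUniformlyOn_of_forall_tendsto (hK)
    (F := fun (n : ℕ) (x : UnitSphere) => potential (fun y => min (f y) n) x)
    (f := fun x : UnitSphere => potential f x) ?_ ?_ ?_ ?_
  · rw [Metric.tendstoUniformlyOn_iff] at hunif
    obtain ⟨n, hn⟩ := (hunif η hη).exists
    refine ⟨n, fun x hx => ?_⟩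
    have := (abs_lt.1 (Real.dist_eq _ _ ▸ hn x hx)).2
    linarith
  · intro n
    exact ((continuousOn_potential_of_bounded (hint n) (hbd n)).comp_continuous
      continuous_subtype_val fun x => by simp).continuousOn
  · intro x _ m n hmn
    have hx := (norm_unitSphere x).le
    refine integral_mono (integrable_green_mul_of_bounded (hint m) (hbd m) hx)
      (integrable_green_mul_of_bounded (hint n) (hbd n) hx) fun y => ?_
    have := interiorGreen_nonneg hx y
    dsimp only
    gcongr
  · intro x hx
    obtain ⟨r, hr, M, hM⟩ := hloc x hx
    have h := continuousWithinAt_potential_of_locallyBounded hf hr hM (norm_unitSphere x).le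
    exact ContinuousWithinAt.comp (f := fun x : UnitSphere => (x : Space3)) h
      continuous_subtype_val.continuousWithinAt fun y _ => by simp
  · intro x hx
    obtain ⟨r, hr, M, hM⟩ := hloc x hx
    have hx' := (norm_unitSphere x).le
    refine tendsto_integral_of_dominated_convergence (fun y => interiorGreen x y * f y)
      (fun n => (integrable_green_mul_of_bounded (hint n) (hbd n) hx').1)
      (integrable_green_mul_of_locallyBounded hf hr hM hx' (by simp; positivity)) ?_ ?_
    · refine fun n => ae_of_all _ fun y => ?_
      have h0 := interiorGreen_nonneg hx' y
      rw [Real.norm_of_nonneg (mul_nonneg h0 (hnn n y))]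
      gcongr
      exact min_le_left _ _
    · refine ae_of_all _ fun y => tendsto_const_nhds.mul (tendsto_const_nhds.congr' ?_)
      filter_upwards [tendsto_natCast_atTop_atTop.eventually_ge_atTop (f y)] with n hn
      exact (min_eq_left hn).symm

/-- Inner regularity of the finite measure f dS on the open set Γ_A, which carries all of its mass.
-/
lemma exists_isCompact_setIntegral_compl_lt {f : UnitSphere → ℝ} (hf : Integrable f surfaceMeasure)
    (hf0 : ∀ y, 0 ≤ f y) (hopen : IsOpen ΓA) (hfΓ : ∀ y ∉ ΓA, f y = 0) {η : ℝ} (hη : 0 < η) :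
    ∃ K ⊆ ΓA, IsCompact K ∧ ∫ y, f y ∂surfaceMeasure - η < ∫ y in K, f y ∂surfaceMeasure := by
  set ν := surfaceMeasure.withDensity fun y => ENNReal.ofReal (f y)
  have : IsFiniteMeasure ν := isFiniteMeasure_withDensity_ofReal hf.2
  obtain ⟨K, hKΓ, hK, h⟩ := hopen.measurableSet.exists_isCompact_lt_add (μ := ν)
    (measure_ne_top _ _) (ENNReal.ofReal_pos.2 hη).ne'
  have hν : ∀ s, MeasurableSet s → ν s = ENNReal.ofReal (∫ y in s, f y ∂surfaceMeasure) := by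
    intro s hs
    rw [withDensity_apply _ hs,
      ofReal_integral_eq_lintegral_ofReal hf.integrableOn (ae_of_all _ hf0)]
  have hK0 : 0 ≤ ∫ y in K, f y ∂surfaceMeasure := integral_nonneg hf0
  rw [hν _ hopen.measurableSet, hν _ hK.measurableSet, ← ENNReal.ofReal_add hK0 hη.le,
    setIntegral_eq_integral_of_forall_compl_eq_zero hfΓ,
    ENNReal.ofReal_lt_ofReal_iff (by linarith)] at h
  exact ⟨K, hKΓ, hK, by linarith⟩

lemma totalDensity_ne_zero (hopen : IsOpen ΓA) (hne : ΓA.Nonempty)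
    (hcont : ContinuousOn σ ΓA) (hint : IntegrableOn σ ΓA surfaceMeasure)
    (heq : ∀ x ∈ ΓA, singleLayer ΓA σ x = 1) : totalDensity ΓA σ ≠ 0 := by
  intro hI
  set f := ΓA.indicator σ with hfdef
  have hf : Integrable f surfaceMeasure := (integrable_indicator_iff hopen.measurableSet).2 hint
  have hI' : ∫ y, f y ∂surfaceMeasure = 0 := (integral_indicator hopen.measurableSet).trans hI
  have hloc := fun x (hx : x ∈ ΓA) => isLocallyBounded_indicator hopen hcont hx
  set p : UnitSphere → ℝ := fun y => max (f y) 0 with hp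
  set m : UnitSphere → ℝ := fun y => max (-f y) 0 with hm
  have hp0 : ∀ y, 0 ≤ p y := fun y => le_max_right _ _
  have hm0 : ∀ y, 0 ≤ m y := fun y => le_max_right _ _
  have hpm : ∀ y, p y - m y = f y := fun y => max_zero_sub_max_neg_zero_eq_self (f y)
  have hpi : Integrable p surfaceMeasure := hf.pos_part
  have hmi : Integrable m surfaceMeasure := hf.neg_part
  have hpf : ∀ y, |p y| ≤ |f y| := fun y => by
    rw [abs_of_nonneg (hp0 y)]; exact max_le (le_abs_self _) (abs_nonneg _)
  have hmf : ∀ y, |m y| ≤ |f y| := fun y => by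
    rw [abs_of_nonneg (hm0 y)]; exact max_le (neg_le_abs _) (abs_nonneg _)
  have hpm_int : ∫ y, p y ∂surfaceMeasure = ∫ y, m y ∂surfaceMeasure := by
    rw [← sub_eq_zero, ← integral_sub hpi hmi]
    simp only [hpm, hI']
  obtain ⟨C, hC, hCg⟩ := exists_integral_green_le
  -- a compact set of positive measure
  have hΓpos : 0 < surfaceMeasure ΓA := hopen.measure_pos ((volume : Measure Space3).toSphere) hne
  obtain ⟨K₀, hK₀Γ, hK₀, hK₀pos⟩ : ∃ K₀ ⊆ ΓA, IsCompact K₀ ∧ 0 < surfaceMeasure.real K₀ := by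
    obtain ⟨K, hKΓ, hK, h⟩ := hopen.measurableSet.exists_isCompact_lt_add (μ := surfaceMeasure)
      (measure_ne_top _ _) hΓpos.ne'
    refine ⟨K, hKΓ, hK, ?_⟩
    refine ENNReal.toReal_pos (fun h0 => ?_) (measure_ne_top _ _)
    rw [h0, zero_add] at h
    exact lt_irrefl _ h
  -- The potential of the added density ε on K₀ is at most Cε = 1/4. Its mass ε|K₀| is exactly the
  -- tolerance for the part of m lost outside K₁, so b₁ + b₂ outweighs m, hence p and a.
  set ε : ℝ := 1 / (4 * C) with hε
  have hε0 : 0 < ε := by positivity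
  obtain ⟨K₁, hK₁Γ, hK₁, hK₁int⟩ := exists_isCompact_setIntegral_compl_lt hmi hm0 hopen
    (fun y hy => by simp [hm, hfdef, hy]) (mul_pos hε0 hK₀pos)
  set K := K₀ ∪ K₁ with hKdef
  have hK : IsCompact K := hK₀.union hK₁
  have hKΓ : K ⊆ ΓA := union_subset hK₀Γ hK₁Γ
  obtain ⟨n, hn⟩ := exists_potential_truncation hpi hp0 hK
    (fun x hx => by
      obtain ⟨r, hr, M, hM⟩ := hloc x (hKΓ hx)
      exact ⟨r, hr, M, fun y hy => (hpf y).trans (hM y hy)⟩) (show (0 : ℝ) < 1 / 4 by norm_num)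
  set a : UnitSphere → ℝ := fun y => min (p y) n with ha
  set b₁ : UnitSphere → ℝ := K.indicator m with hb₁
  set b₂ : UnitSphere → ℝ := K₀.indicator fun _ => ε with hb₂
  have hai : Integrable a surfaceMeasure := hpi.inf (integrable_const _)
  have hb₁i : Integrable b₁ surfaceMeasure := hmi.indicator hK.measurableSet
  have hb₂i : Integrable b₂ surfaceMeasure := (integrable_const _).indicator hK₀.measurableSet
  have ha0 : ∀ y, 0 ≤ a y := fun y => le_min (hp0 y) (Nat.cast_nonneg n)
  have hA : ∀ y, |a y| ≤ n := fun y => by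
    rw [abs_of_nonneg (ha0 y)]; exact min_le_right _ _
  obtain ⟨M, hM⟩ := hK.exists_bound_of_continuousOn (hcont.mono hKΓ)
  have hB₁ : ∀ y, |b₁ y| ≤ max M 0 := fun y => by
    by_cases hy : y ∈ K
    · rw [hb₁, indicator_of_mem hy]
      refine (hmf y).trans ((?_ : _ ≤ M).trans (le_max_left _ _))
      rw [hfdef, indicator_of_mem (hKΓ hy)]
      exact hM y hy
    · rw [hb₁, indicator_of_notMem hy]; simp
  have hB₂ : ∀ y, |b₂ y| ≤ ε := fun y => by
    by_cases hy : y ∈ K₀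
    · rw [hb₂, indicator_of_mem hy, abs_of_pos hε0]
    · rw [hb₂, indicator_of_notMem hy, abs_zero]; exact hε0.le
  have hB : ∀ y, |(b₁ + b₂) y| ≤ max M 0 + ε := fun y =>
    (abs_add_le _ _).trans (add_le_add (hB₁ y) (hB₂ y))
  have hab : ∫ y, a y ∂surfaceMeasure < ∫ y, (b₁ + b₂) y ∂surfaceMeasure := by
    have h1 : ∫ y, a y ∂surfaceMeasure ≤ ∫ y, p y ∂surfaceMeasure :=
      integral_mono hai hpi fun y => min_le_left _ _
    have h2 : ∫ y, b₂ y ∂surfaceMeasure = ε * surfaceMeasure.real K₀ := by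
      rw [hb₂, integral_indicator hK₀.measurableSet]; simp [mul_comm]
    have h3 : ∫ y in K₁, m y ∂surfaceMeasure ≤ ∫ y, b₁ y ∂surfaceMeasure := by
      rw [hb₁, integral_indicator hK.measurableSet]
      exact setIntegral_mono_set hmi.integrableOn (ae_of_all _ hm0)
        (Eventually.of_forall subset_union_right)
    rw [integral_add' hb₁i hb₂i]
    linarith
  obtain ⟨x, hxK, hx⟩ := exists_potential_sub_lt hai ha0 hA (hb₁i.add hb₂i) hB hK.isClosed
    (fun y hy => by
      have hy₀ : y ∉ K₀ := fun h => hy (Or.inl h)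
      simp [hb₁, hb₂, hy, hy₀]) hab (show (0 : ℝ) < 1 / 2 by norm_num)
  have hxΓ := hKΓ hxK
  have hx1 := (norm_unitSphere x).le
  obtain ⟨r, hr, L, hL⟩ := hloc x hxΓ
  have hGp := integrable_green_mul_of_locallyBounded hpi hr
    (fun y hy => (hpf y).trans (hL y hy)) hx1 (by simp; positivity)
  have hGm := integrable_green_mul_of_locallyBounded hmi hr
    (fun y hy => (hmf y).trans (hL y hy)) hx1 (by simp; positivity)
  have e1 : potential p x - potential m x = 1 := by
    refine Eq.trans ?_ (heq x hxΓ)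
    rw [singleLayer_eq_potential hopen.measurableSet]
    unfold potential
    rw [← integral_sub hGp hGm]
    simp_rw [← mul_sub, hpm]
    rfl
  have e2 : potential (b₁ + b₂) x = potential b₁ x + potential b₂ x := by
    unfold potential
    rw [← integral_add (integrable_green_mul_of_bounded hb₁i hB₁ hx1)
      (integrable_green_mul_of_bounded hb₂i hB₂ hx1)]
    simp_rw [Pi.add_apply, mul_add]
  have e3 : potential b₁ x ≤ potential m x := by
    refine integral_mono (integrable_green_mul_of_bounded hb₁i hB₁ hx1) hGm fun y => ?_
    exact mul_le_mul_of_nonneg_left (indicator_le_self' (fun y _ => hm0 y) y) (interiorGreen_nonneg hx1 y)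
  have e4 : potential b₂ x ≤ 1 / 4 := by
    calc potential b₂ x ≤ ∫ y, interiorGreen x y * ε ∂surfaceMeasure := by
          refine integral_mono (integrable_green_mul_of_bounded hb₂i hB₂ hx1)
            ((integrable_green hx1).mul_const ε) fun y => ?_
          exact mul_le_mul_of_nonneg_left ((le_abs_self _).trans (hB₂ y)) (interiorGreen_nonneg hx1 y)
      _ ≤ C * ε := by
          rw [integral_mul_const]
          exact mul_le_mul_of_nonneg_right (hCg x hx1) hε0.le
      _ = 1 / 4 := by rw [hε]; field_simp
  -- At x the difference of potentials exceeds 1 - 1/4 - 1/4 = 1/2: one quarter is lost by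
  -- truncating p, one by adding b₂, and restricting m to K only helps.
  have e5 := hn x hxK
  linarith

end

end

theorem mainTheorem1 (ΓA : Set UnitSphere) (hopen : IsOpen ΓA) (hne : ΓA.Nonempty)
    (σ : UnitSphere → ℝ) (hcont : ContinuousOn σ ΓA) (hint : IntegrableOn σ ΓA surfaceMeasure)
    (heq : ∀ x ∈ ΓA, singleLayer ΓA σ x = 1) :
    SolvesMixedProblem ΓA (-totalDensity ΓA σ) (singleLayer ΓA σ) ∧
      totalDensity ΓA σ ≠ 0 :=
  ⟨solvesMixedProblem_singleLayer hopen hcont hint heq,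
    totalDensity_ne_zero hopen hne hcont hint heq⟩
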